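/- For integers $n\ge m\ge 1$ let $\mathrm{IMS2}(n,m)$ be the set of two-dimensional integer arrays $A[0..n-1][0..n-1]$ with $0\le A[i][j]<m$ for all $i,j$ that are non-decreasing along every row and along every column. Computation is on a word RAM with word size $w=\Omega(\log n)$: arithmetic, bitwise and comparison operations on $w$-bit words and memory accesses take unit time. There is a single query algorithm, together with absolute constants (also for the lower bound on $w$), such that the following holds. For all integers $n\ge m\ge 1$ and $k\ge 0$, every $A\in\mathrm{IMS2}(n,m)$ and every such $w$ there is a data structure, that is, a bit string stored in read-only memory, of $$O\!\left(4^k\,n\,m\left(\frac nm\right)^{1/2^{2^k}}\right)$$ bits, from which the algorithm, given $i,j\in\{0,\dots,n-1\}$, outputs the entry $A[i][j]$ in $O(2^k)$ time. The constants in both bounds do not depend on $n,m,k,A,w$ or $(i,j)$. -/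

import Mathlib

/-- `IMS2 n m`: the two-dimensional arrays `A[0..n-1][0..n-1]` of integers with `0 ≤ A[i][j] < m`
that are non-decreasing along every row and along every column. -/
def IMS2 (n m : ℕ) : Set (Fin n → Fin n → ℕ) :=
  {A | (∀ i, Monotone (fun j => A i j)) ∧ (∀ j, Monotone (fun i => A i j)) ∧ ∀ i j, A i j < m}

/-! A word RAM with word size `w`, a read-only data memory holding the data structure, a read-write
working memory and registers.  Every word is a natural number below `2 ^ w`, and every arithmetic,
bitwise or comparison operation, memory access and register access has unit cost. -/
namespace WordRAM

/-- The unit-cost binary operations. -/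
inductive BinOp : Type
  | add | sub | mul | div | mod
  | and | or | xor | shl | shr
  | lt | eq

/-- Operations on `w`-bit words: arithmetic is modulo `2 ^ w`, division by zero gives zero,
comparisons return `0` or `1`. -/
def BinOp.eval (w : ℕ) : BinOp → ℕ → ℕ → ℕ
  | add, x, y => (x + y) % 2 ^ w
  | sub, x, y => (x + (2 ^ w - y)) % 2 ^ w
  | mul, x, y => (x * y) % 2 ^ w
  | div, x, y => x / y
  | mod, x, y => if y = 0 then 0 else x % y
  | and, x, y => x &&& y
  | or, x, y => x ||| y
  | xor, x, y => x ^^^ y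
  | shl, x, y => (x * 2 ^ y) % 2 ^ w
  | shr, x, y => x / 2 ^ y
  | lt, x, y => if x < y then 1 else 0
  | eq, x, y => if x = y then 1 else 0

/-- Expressions: literals, registers, a word of the read-only data memory, a word of the working
memory, and binary operations. -/
inductive Expr : Type
  | lit (c : ℕ)
  | reg (r : ℕ)
  | data (addr : Expr)
  | ram (addr : Expr)
  | op (o : BinOp) (e₁ e₂ : Expr)

/-- The number of unit-cost steps needed to evaluate an expression. -/
def Expr.cost : Expr → ℕ
  | lit _ => 1
  | reg _ => 1
  | data e => e.cost + 1
  | ram e => e.cost + 1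
  | op _ e₁ e₂ => e₁.cost + e₂.cost + 1

/-- Programs. -/
inductive Cmd : Type
  | skip
  | assign (r : ℕ) (e : Expr)
  | store (addr val : Expr)
  | seq (c₁ c₂ : Cmd)
  | ite (e : Expr) (c₁ c₂ : Cmd)
  | while (e : Expr) (c : Cmd)

/-- The mutable part of the machine: registers and working memory. -/
structure State : Type where
  reg : ℕ → ℕ
  ram : ℕ → ℕ

/-- The `a`-th `w`-bit word of the bit string `D` (least significant bit first; bits beyond the end
of `D` read as zero). -/
def dataWord (w : ℕ) (D : List Bool) (a : ℕ) : ℕ :=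
  Nat.ofBits (fun b : Fin w => D.getD (a * w + b) false)

/-- The value of an expression on a machine with word size `w` and data memory `D`. -/
def Expr.eval (w : ℕ) (D : List Bool) (s : State) : Expr → ℕ
  | lit c => c % 2 ^ w
  | reg r => s.reg r
  | data e => dataWord w D (e.eval w D s)
  | ram e => s.ram (e.eval w D s)
  | op o e₁ e₂ => o.eval w (e₁.eval w D s) (e₂.eval w D s)

/-- `Exec w D c s T s₁`: on a machine with word size `w` and data memory `D`, the program `c`
started in state `s` halts in state `s₁` after exactly `T` steps. -/
inductive Exec (w : ℕ) (D : List Bool) : Cmd → State → ℕ → State → Prop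
  | skip (s : State) : Exec w D Cmd.skip s 1 s
  | assign (s : State) (r : ℕ) (e : Expr) :
      Exec w D (Cmd.assign r e) s (e.cost + 1)
        { s with reg := Function.update s.reg r (e.eval w D s) }
  | store (s : State) (e₁ e₂ : Expr) :
      Exec w D (Cmd.store e₁ e₂) s (e₁.cost + e₂.cost + 1)
        { s with ram := Function.update s.ram (e₁.eval w D s) (e₂.eval w D s) }
  | seq (c₁ c₂ : Cmd) (s s₁ s₂ : State) (T₁ T₂ : ℕ) :
      Exec w D c₁ s T₁ s₁ → Exec w D c₂ s₁ T₂ s₂ → Exec w D (Cmd.seq c₁ c₂) s (T₁ + T₂) s₂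
  | ite_true (e : Expr) (c₁ c₂ : Cmd) (s s₁ : State) (T : ℕ) :
      e.eval w D s ≠ 0 → Exec w D c₁ s T s₁ →
        Exec w D (Cmd.ite e c₁ c₂) s (e.cost + 1 + T) s₁
  | ite_false (e : Expr) (c₁ c₂ : Cmd) (s s₁ : State) (T : ℕ) :
      e.eval w D s = 0 → Exec w D c₂ s T s₁ →
        Exec w D (Cmd.ite e c₁ c₂) s (e.cost + 1 + T) s₁
  | while_true (e : Expr) (c : Cmd) (s s₁ s₂ : State) (T₁ T₂ : ℕ) :
      e.eval w D s ≠ 0 → Exec w D c s T₁ s₁ → Exec w D (Cmd.while e c) s₁ T₂ s₂ →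
        Exec w D (Cmd.while e c) s (e.cost + 1 + T₁ + T₂) s₂
  | while_false (e : Expr) (c : Cmd) (s : State) :
      e.eval w D s = 0 → Exec w D (Cmd.while e c) s (e.cost + 1) s

/-- The initial state for a query `(i, j)`: registers `0`, `1`, `2` hold `i`, `j` and the word size;
all other registers and the working memory are zero. -/
def State.init (w i j : ℕ) : State where
  reg r := if r = 0 then i % 2 ^ w else if r = 1 then j % 2 ^ w else if r = 2 then w else 0
  ram _ := 0

/-- On a machine with word size `w` and data memory `D`, the program `P` answers the query `(i, j)`
with the value `v` (left in register `0`) in at most `T` steps. -/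
def Answers (w : ℕ) (D : List Bool) (P : Cmd) (i j v T : ℕ) : Prop :=
  ∃ (t : ℕ) (s : State), t ≤ T ∧ Exec w D P (State.init w i j) t s ∧ s.reg 0 = v

end WordRAM

/-! Cover the array by a square of side `2 ^ e` with `2 ^ e = Θ(n)` and cut it recursively into
square blocks. A node stores, for every child, the first entry of the child minus its own first
entry; a query adds these offsets on its way down and stops at a constant block, which takes no
space.

Two facts control the space. First, call last minus first entry the difference of a block;
telescoping along rows and columns bounds the total difference of the `N * N` blocks of one level by
`2 * N * M`, where `M` bounds the entries (`sum_blockDiff_le`). So at most `2 * N * M` of them are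
non-constant. Second, child positions are relative to the node, so a node of side `2 ^ s` and
difference `d` needs fields of only `O(s + log d)` bits instead of `O(log n)` (`length_enc_le`).

Let `2 ^ r ≈ n / m`, `u ≈ log e`, `v ≈ log u`. The steps from side `2 ^ e` to `2 ^ (r + 2 * u)` and
on to `2 ^ max r v` cost `O(n * m)` by counting all blocks, because `n ^ 2 ≈ n * m * 2 ^ r`
(`totalLength_top_le`).

If `v ≤ r`, exponents then drop from `s` to `s - s / 4`. Each such step costs `O(n * m)`: there are
`O(n * m / 2 ^ s)` non-constant blocks with `4 ^ (s / 4)` children each, and `4 ^ (s / 4) * s = O(2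
^ s)`. After `3 * (2 ^ k + 1)` steps the exponent is at most `r / 2 ^ (2 ^ k + 1) + 3`, and storing
the remaining blocks cell by cell produces the factor `(n / m) ^ (1 / 2 ^ (2 ^ k))`.

If `r < v`, the remaining blocks have side `B = 2 ^ v = Θ(log log n)`. A monotone block of
difference `d` is given by `d` boundary paths, so there are at most `4 ^ (B * d)` of them
(`card_monoBlocks_le`). A table of those with `d < B ^ 2` takes `2 ^ O(B ^ 3) = O(n)` bits. It is
ordered by `d`, so a reference takes `O(B * d)` bits, and these sum to `O(n * m)`. Blocks with `d ≥
B ^ 2` fit into `O(B * d)` bits cell by cell.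

The program reads all block sides and field widths from the data, so it depends on no parameter.
`Located` describes a descent without the machine; `exec_descent` executes it at constant cost per
level. -/

/-! ### Bit fields of a bit string -/

/-- The number written in the `W` bits of `D` that start at position `p`. -/
def bitField (D : List Bool) (p W : ℕ) : ℕ := Nat.ofBits (fun b : Fin W => D.getD (p + b) false)

/-- The `W` lowest bits of `v`, least significant first. -/
def natBits (W v : ℕ) : List Bool := (List.range W).map v.testBit

@[simp] theorem length_natBits (W v : ℕ) : (natBits W v).length = W := by simp [natBits]

theorem bitField_lt (D : List Bool) (p W : ℕ) : bitField D p W < 2 ^ W := Nat.ofBits_lt_two_pow _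

theorem testBit_bitField (D : List Bool) (p W i : ℕ) :
    (bitField D p W).testBit i = (decide (i < W) && D.getD (p + i) false) := by
  unfold bitField
  by_cases h : i < W
  · rw [Nat.testBit_ofBits_lt _ _ h]; simp [h]
  · rw [Nat.testBit_ofBits_ge _ _ (not_lt.1 h)]; simp [h]

theorem bitField_div_mod (D : List Bool) (p w a W : ℕ) (h : a + W ≤ w) :
    bitField D p w / 2 ^ a % 2 ^ W = bitField D (p + a) W := by
  refine Nat.eq_of_testBit_eq fun i => ?_
  rw [Nat.testBit_mod_two_pow, Nat.testBit_div_two_pow, testBit_bitField, testBit_bitField]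
  by_cases hi : i < W
  · have : a + i < w := by omega
    simp [hi, this, Nat.add_comm i a, Nat.add_assoc]
  · simp [hi]

/-- A bit field that straddles a word boundary, assembled from two words. -/
theorem bitField_of_words (D : List Bool) (p w W : ℕ) (hW : W ≤ w) (hw : 0 < w) :
    (bitField D (p / w * w) w / 2 ^ (p % w) |||
        bitField D ((p / w + 1) * w) w * 2 ^ (w - p % w) % 2 ^ w) % 2 ^ W = bitField D p W := by
  have hs : p % w < w := Nat.mod_lt _ hw
  have hp : p / w * w + p % w = p := Nat.div_add_mod' p w
  refine Nat.eq_of_testBit_eq fun i => ?_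
  simp only [Nat.testBit_mod_two_pow, Nat.testBit_div_two_pow, Nat.testBit_or,
    Nat.testBit_mul_two_pow, testBit_bitField]
  by_cases hi : i < W
  · have hiw : i < w := by omega
    by_cases h1 : i + p % w < w
    · have h2 : ¬ (w - p % w ≤ i) := by omega
      have h3 : p / w * w + (i + p % w) = p + i := by omega
      simp [hi, h1, h2, h3]
    · have h2 : w - p % w ≤ i := by omega
      have h3 : (p / w + 1) * w + (i - (w - p % w)) = p + i := by
        rw [add_mul, one_mul]; omega
      have h4 : i - (w - p % w) < w := by omega
      simp only [hi, h1, h2, h3, h4, hiw]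
      simp
  · simp [hi]

/-- Isolating the lowest set bit. -/
theorem and_two_pow_sub (x H w : ℕ) (hx : x % 2 ^ (H + 1) = 2 ^ H) (hw : x < 2 ^ w) :
    x &&& (2 ^ w - x) = 2 ^ H := by
  have hH : 0 < 2 ^ H := by positivity
  have hdm := Nat.div_add_mod x (2 ^ (H + 1))
  rw [hx] at hdm
  set z := x / 2 ^ (H + 1) with hz
  have hx' : x = 2 ^ H * (2 * z + 1) := by rw [← hdm]; ring
  have hy : x = (x - 1) + 1 := by omega
  have hy' : x - 1 = 2 ^ (H + 1) * z + (2 ^ H - 1) := by omega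
  have hHw : H < w := by
    by_contra hc
    have := Nat.pow_le_pow_right (n := 2) (by norm_num) (not_lt.1 hc)
    nlinarith
  refine Nat.eq_of_testBit_eq fun i => ?_
  rw [Nat.testBit_and]
  conv_lhs => rw [hy]
  -- `2 ^ w - ((x - 1) + 1)` is the bitwise complement of `x - 1`. The number `x - 1` agrees with
  -- `x` above bit `H`, has a zero there and ones below.
  rw [Nat.testBit_two_pow_sub_succ (by omega), ← hy]
  rcases lt_trichotomy i H with h | h | h
  · have : x.testBit i = false := by
      rw [hx', Nat.testBit_two_pow_mul]; simp [h]
    rw [this, Nat.testBit_two_pow]; simp; omega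
  · subst h
    have h1 : x.testBit i = true := by
      rw [hx', Nat.testBit_two_pow_mul]; simp
    have h2 : (x - 1).testBit i = false := by
      rw [hy', Nat.testBit_two_pow_mul_add _ (by rw [pow_succ]; omega)]
      rw [if_pos (by omega)]
      exact Nat.testBit_lt_two_pow (by omega)
    rw [h1, h2, Nat.testBit_two_pow]; simp [hHw]
  · have h1 : (x - 1).testBit i = x.testBit i := by
      rw [hy', ← hdm, Nat.testBit_two_pow_mul_add _ (by rw [pow_succ]; omega),
        Nat.testBit_two_pow_mul_add _ (by rw [pow_succ]; omega)]
      rw [if_neg (by omega), if_neg (by omega)]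
    rw [h1, Nat.testBit_two_pow]
    have : ¬ H = i := by omega
    simp only [this, decide_false, Bool.and_eq_false_iff]
    cases x.testBit i <;> simp

/-! ### Occurrences of encoded pieces in the data. -/

/-- The list `E` occurs in `D` at position `p`. -/
def Occ (D : List Bool) (p : ℕ) (E : List Bool) : Prop := E <+: D.drop p

theorem occ_append {D : List Bool} {p : ℕ} {A B : List Bool} (h : Occ D p (A ++ B)) :
    Occ D p A ∧ Occ D (p + A.length) B := by
  obtain ⟨t, ht⟩ := h
  refine ⟨⟨B ++ t, by rw [← ht, List.append_assoc]⟩, ⟨t, ?_⟩⟩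
  rw [← List.drop_drop, ← ht, List.append_assoc, List.drop_left]

theorem Occ.mk (A E B : List Bool) : Occ (A ++ E ++ B) A.length E :=
  ⟨B, by rw [List.append_assoc, List.drop_left]⟩

theorem Occ.trans {D E F : List Bool} {p q : ℕ} (h : Occ D p E) (h' : Occ E q F)
    (hq : q ≤ E.length) : Occ D (p + q) F := by
  obtain ⟨t, ht⟩ := h
  obtain ⟨u, hu⟩ := h'
  refine ⟨u ++ t, ?_⟩
  rw [← List.drop_drop, ← ht, List.drop_append_of_le_length hq, ← hu, List.append_assoc]

/-- The empty string occurs at every position, even beyond the end of the data. This is why `p ≤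
D.length` has to accompany occurrences throughout. -/
theorem Occ.length_le {D E : List Bool} {p : ℕ} (h : Occ D p E) (hp : p ≤ D.length) :
    p + E.length ≤ D.length := by
  have := List.IsPrefix.length_le h
  rw [List.length_drop] at this
  omega

theorem Occ.nil {D : List Bool} {p : ℕ} : Occ D p [] := List.nil_prefix

theorem Occ.bitField {D : List Bool} {p W v : ℕ} (h : Occ D p (natBits W v)) (hv : v < 2 ^ W) :
    bitField D p W = v := by
  refine Nat.eq_of_testBit_eq fun i => ?_
  rw [testBit_bitField]
  by_cases hi : i < W
  · obtain ⟨t, ht⟩ := h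
    have : D.getD (p + i) false = v.testBit i := by
      have h1 : D.getD (p + i) false = (D.drop p).getD i false := by
        simp [List.getD_eq_getElem?_getD, List.getElem?_drop]
      rw [h1, ← ht, List.getD_eq_getElem?_getD, List.getElem?_append_left (by simpa using hi)]
      simp [natBits, hi]
    rw [this]; simp [hi]
  · have : v.testBit i = false := Nat.testBit_lt_two_pow
      (hv.trans_le (Nat.pow_le_pow_right (by norm_num) (not_lt.1 hi)))
    rw [this]; simp [hi]

theorem length_flatMap_range (F : ℕ → List Bool) (N : ℕ) :
    ((List.range N).flatMap F).length = ∑ c ∈ Finset.range N, (F c).length := by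
  induction N with
  | zero => simp
  | succ N ih => simp [List.range_succ, List.flatMap_append, Finset.sum_range_succ, ih]

theorem Occ.flatMap_range {D : List Bool} {F : ℕ → List Bool} :
    ∀ {N p : ℕ}, Occ D p ((List.range N).flatMap F) → ∀ c < N,
      Occ D (p + ∑ c' ∈ Finset.range c, (F c').length) (F c) := by
  intro N
  induction N with
  | zero => intro p _ c hc; omega
  | succ N ih =>
    intro p h c hc
    rw [List.range_succ, List.flatMap_append] at h
    obtain ⟨h1, h2⟩ := occ_append h
    rcases Nat.lt_succ_iff_lt_or_eq.1 hc with hc | rfl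
    · exact ih h1 c hc
    · rw [length_flatMap_range] at h2
      simpa using h2

/-! ### The query program -/

/-- `Located D K h p W i j v`: starting from the node at position `p` with field width `W`, at most
`h` steps of the descent accumulate the value `v` at the cell `(i, j)`.  All field widths met on
the way are at most `K`. -/
inductive Located (D : List Bool) (K : ℕ) : ℕ → ℕ → ℕ → ℕ → ℕ → ℕ → Prop
  | done (h p i j : ℕ) : Located D K h p 0 i j 0
  | grid (h p W i j b q e v ptr W' z : ℕ) (hW : 0 < W) (hK : W ≤ K) (hb0 : b ≠ 0)
      (hb : bitField D p W = b) (hq : bitField D (p + W) W = q)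
      (he : e = p + 3 * W + (i / b * q + j / b) * (3 * W))
      (hv : bitField D e W = v) (hptr : bitField D (e + W) W = ptr)
      (hW' : bitField D (e + (W + W)) W = W') (hl : e + 3 * W ≤ D.length)
      (hl' : p + 3 * W + 3 * W * (q * q) + ptr ≤ D.length)
      (hz : Located D K h (p + 3 * W + 3 * W * (q * q) + ptr) W' (i % b) (j % b) z) :
      Located D K (h + 1) p W i j (v + z)
  | jump (h p W i j p' W' z : ℕ) (hW : 0 < W) (hK : W ≤ K)
      (hb : bitField D p W = 0) (hp' : bitField D (p + W) W = p')
      (hW' : bitField D (p + (W + W)) W = W') (hl : p + 3 * W ≤ D.length) (hl' : p' ≤ D.length)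
      (hz : Located D K h p' W' i j z) :
      Located D K (h + 1) p W i j z

theorem Located.mono {D : List Bool} {K h p W i j v : ℕ} (H : Located D K h p W i j v) :
    ∀ {h' : ℕ}, h ≤ h' → Located D K h' p W i j v := by
  induction H with
  | done => intro h' _; exact .done ..
  | grid h p W i j b q e v ptr W' z hW hK hb0 hb hq he hv hptr hW' hl hl' hz ih =>
    intro h' hh
    obtain ⟨k, rfl⟩ : ∃ k, h' = k + 1 := ⟨h' - 1, by omega⟩
    exact .grid k p W i j b q e v ptr W' z hW hK hb0 hb hq he hv hptr hW' hl hl' (ih (by omega))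
  | jump h p W i j p' W' z hW hK hb hp' hW' hl hl' hz ih =>
    intro h' hh
    obtain ⟨k, rfl⟩ : ∃ k, h' = k + 1 := ⟨h' - 1, by omega⟩
    exact .jump k p W i j p' W' z hW hK hb hp' hW' hl hl' (ih (by omega))

/-! ### Evaluation of expressions without overflow. -/

namespace WordRAM

/-- Reads the bit field that starts at position `p` and has width `W`. -/
def readExpr (p W : Expr) : Expr :=
  .op .mod
    (.op .or
      (.op .shr (.data (.op .div p (.reg 2))) (.op .mod p (.reg 2)))
      (.op .shl (.data (.op .add (.op .div p (.reg 2)) (.lit 1)))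
        (.op .sub (.reg 2) (.op .mod p (.reg 2)))))
    (.op .shl (.lit 1) W)

theorem eval_reg {w : ℕ} {D : List Bool} {s : State} {r x : ℕ} (h : s.reg r = x) :
    (Expr.reg r).eval w D s = x := h

theorem eval_add {w : ℕ} {D : List Bool} {s : State} {e₁ e₂ : Expr} {x y : ℕ}
    (h₁ : e₁.eval w D s = x) (h₂ : e₂.eval w D s = y) (h : x + y < 2 ^ w) :
    (Expr.op .add e₁ e₂).eval w D s = x + y := by
  simp only [Expr.eval, BinOp.eval, h₁, h₂, Nat.mod_eq_of_lt h]

theorem eval_mul {w : ℕ} {D : List Bool} {s : State} {e₁ e₂ : Expr} {x y : ℕ}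
    (h₁ : e₁.eval w D s = x) (h₂ : e₂.eval w D s = y) (h : x * y < 2 ^ w) :
    (Expr.op .mul e₁ e₂).eval w D s = x * y := by
  simp only [Expr.eval, BinOp.eval, h₁, h₂, Nat.mod_eq_of_lt h]

theorem eval_div {w : ℕ} {D : List Bool} {s : State} {e₁ e₂ : Expr} {x y : ℕ}
    (h₁ : e₁.eval w D s = x) (h₂ : e₂.eval w D s = y) :
    (Expr.op .div e₁ e₂).eval w D s = x / y := by
  simp only [Expr.eval, BinOp.eval, h₁, h₂]

theorem eval_mod {w : ℕ} {D : List Bool} {s : State} {e₁ e₂ : Expr} {x y : ℕ}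
    (h₁ : e₁.eval w D s = x) (h₂ : e₂.eval w D s = y) (h : y ≠ 0) :
    (Expr.op .mod e₁ e₂).eval w D s = x % y := by
  simp only [Expr.eval, BinOp.eval, h₁, h₂, if_neg h]

theorem eval_lit {w : ℕ} {D : List Bool} {s : State} {c : ℕ} (h : c < 2 ^ w) :
    (Expr.lit c).eval w D s = c := by
  simp only [Expr.eval, Nat.mod_eq_of_lt h]

/-- The bound on `x + 1` keeps the index of the second word from wrapping around, and `y < w` makes
the modulus `2 ^ y` representable in a word. -/
theorem eval_readExpr {w : ℕ} {D : List Bool} {s : State} {p W : Expr} {x y : ℕ}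
    (hp : p.eval w D s = x) (hW : W.eval w D s = y) (hs : s.reg 2 = w) (hx : x + 1 < 2 ^ w)
    (hy : y < w) : (readExpr p W).eval w D s = bitField D x y := by
  have hw : 0 < w := by omega
  have hw2 : w < 2 ^ w := Nat.lt_two_pow_self
  have h1 : (1 : ℕ) % 2 ^ w = 1 := Nat.mod_eq_of_lt (by omega)
  have h2 : (x / w + 1) % 2 ^ w = x / w + 1 :=
    Nat.mod_eq_of_lt (by have := Nat.div_le_self x w; omega)
  have h3 : (w + (2 ^ w - x % w)) % 2 ^ w = w - x % w := by
    have := Nat.mod_lt x hw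
    rw [show w + (2 ^ w - x % w) = (w - x % w) + 2 ^ w by omega, Nat.add_mod_right]
    exact Nat.mod_eq_of_lt (by omega)
  have h4 : 1 * 2 ^ y % 2 ^ w = 2 ^ y := by
    rw [one_mul]; exact Nat.mod_eq_of_lt (Nat.pow_lt_pow_right (by norm_num) hy)
  have h5 : (2 : ℕ) ^ y ≠ 0 := by positivity
  have h6 : ∀ a, dataWord w D a = bitField D (a * w) w := fun _ => rfl
  simp only [readExpr, Expr.eval, BinOp.eval, hp, hW, hs, if_neg hw.ne', h1, h2, h3, h4, if_neg h5,
    h6]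
  exact bitField_of_words D x w y hy.le hw

/-! ### Straight-line code and the descent loop. -/

/-- A sequence of register assignments. -/
def assigns : List (ℕ × Expr) → Cmd
  | [] => .skip
  | a :: l => .seq (.assign a.1 a.2) (assigns l)

/-- The running time of a sequence of assignments. -/
def assignsCost : List (ℕ × Expr) → ℕ
  | [] => 1
  | a :: l => (a.2.cost + 1) + assignsCost l

/-- The state after an assignment. -/
def State.set (s : State) (r v : ℕ) : State := { s with reg := Function.update s.reg r v }

theorem State.set_reg (s : State) (r v r' : ℕ) :
    (s.set r v).reg r' = if r' = r then v else s.reg r' := by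
  simp [State.set, Function.update_apply]

/-- The state after a sequence of assignments. -/
def runAssigns (w : ℕ) (D : List Bool) : List (ℕ × Expr) → State → State
  | [], s => s
  | a :: l, s => runAssigns w D l (s.set a.1 (a.2.eval w D s))

theorem exec_assigns (w : ℕ) (D : List Bool) (l : List (ℕ × Expr)) :
    ∀ s, Exec w D (assigns l) s (assignsCost l) (runAssigns w D l s) := by
  induction l with
  | nil => exact fun s => .skip s
  | cons a l ih => exact fun s => .seq _ _ _ _ _ _ _ (.assign s a.1 a.2) (ih _)

/-- Reads the first two header fields of the current node. -/
def loadNode : List (ℕ × Expr) :=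
  [(6, readExpr (.reg 4) (.reg 5)), (7, readExpr (.op .add (.reg 4) (.reg 5)) (.reg 5))]

/-- Descends from a grid node to one of its children. -/
def gridStep : List (ℕ × Expr) :=
  [(9, .op .mul (.lit 3) (.reg 5)),
   (4, .op .add (.reg 4) (.reg 9)),
   (8, .op .add (.reg 4)
      (.op .mul (.op .add (.op .mul (.op .div (.reg 0) (.reg 6)) (.reg 7))
        (.op .div (.reg 1) (.reg 6))) (.reg 9))),
   (3, .op .add (.reg 3) (readExpr (.reg 8) (.reg 5))),
   (4, .op .add (.op .add (.reg 4) (.op .mul (.reg 9) (.op .mul (.reg 7) (.reg 7))))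
      (readExpr (.op .add (.reg 8) (.reg 5)) (.reg 5))),
   (5, readExpr (.op .add (.reg 8) (.op .add (.reg 5) (.reg 5))) (.reg 5)),
   (0, .op .mod (.reg 0) (.reg 6)),
   (1, .op .mod (.reg 1) (.reg 6))]

/-- Follows an absolute reference. -/
def jumpStep : List (ℕ × Expr) :=
  [(5, readExpr (.op .add (.reg 4) (.op .add (.reg 5) (.reg 5))) (.reg 5)), (4, .reg 7)]

/-- One step of the descent. -/
def descendStep : Cmd :=
  .seq (assigns loadNode) (.ite (.reg 6) (assigns gridStep) (assigns jumpStep))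

/-- The cost of one iteration of the descent. -/
def stepCost : ℕ := 4 + assignsCost loadNode + assignsCost gridStep + assignsCost jumpStep

/-- The registers that matter during the descent. -/
structure Holds (s : State) (w i j acc p W : ℕ) : Prop where
  r0 : s.reg 0 = i
  r1 : s.reg 1 = j
  r2 : s.reg 2 = w
  r3 : s.reg 3 = acc
  r4 : s.reg 4 = p
  r5 : s.reg 5 = W

theorem holds_loadNode {w i j acc p W : ℕ} {D : List Bool} {s : State} (hs : Holds s w i j acc p W)
    (hW : W < w) (hp : p + W + 1 < 2 ^ w) :
    Holds (runAssigns w D loadNode s) w i j acc p W ∧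
      (runAssigns w D loadNode s).reg 6 = bitField D p W ∧
      (runAssigns w D loadNode s).reg 7 = bitField D (p + W) W := by
  obtain ⟨h0, h1, h2, h3, h4, h5⟩ := hs
  simp only [runAssigns, loadNode]
  have e1 : (readExpr (.reg 4) (.reg 5)).eval w D s = bitField D p W :=
    eval_readExpr h4 h5 h2 (by omega) hW
  rw [e1]
  set s1 := s.set 6 (bitField D p W) with hs1
  have g2 : s1.reg 2 = w := by simp [hs1, State.set_reg, h2]
  have g4 : s1.reg 4 = p := by simp [hs1, State.set_reg, h4]
  have g5 : s1.reg 5 = W := by simp [hs1, State.set_reg, h5]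
  have e2 : (readExpr (.op .add (.reg 4) (.reg 5)) (.reg 5)).eval w D s1 = bitField D (p + W) W :=
    eval_readExpr (eval_add g4 g5 (by omega)) g5 g2 (by omega) hW
  rw [e2]
  refine ⟨⟨?_, ?_, ?_, ?_, ?_, ?_⟩, ?_, ?_⟩ <;>
    simp [hs1, State.set_reg, h0, h1, h2, h3, h4, h5]

theorem holds_jumpStep {w i j acc p W p' : ℕ} {D : List Bool} {s : State}
    (hs : Holds s w i j acc p W) (h7 : s.reg 7 = p') (hW : W < w)
    (hp : p + 2 * W + 1 < 2 ^ w) :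
    Holds (runAssigns w D jumpStep s) w i j acc p' (bitField D (p + (W + W)) W) := by
  obtain ⟨h0, h1, h2, h3, h4, h5⟩ := hs
  simp only [runAssigns, jumpStep]
  have e1 : (readExpr (.op .add (.reg 4) (.op .add (.reg 5) (.reg 5))) (.reg 5)).eval w D s =
      bitField D (p + (W + W)) W :=
    eval_readExpr (eval_add h4 (eval_add h5 h5 (by omega)) (by omega)) h5 h2 (by omega) hW
  rw [e1]
  refine ⟨?_, ?_, ?_, ?_, ?_, ?_⟩ <;>
    simp [Expr.eval, State.set_reg, h0, h1, h2, h3, h7]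

/-- Every intermediate address is bounded by the end `e + 3 * W` of the child's entry or by the
position of the child; both are below `2 ^ w`, so nothing wraps around. -/
theorem holds_gridStep {w i j acc p W b q e : ℕ} {D : List Bool} {s : State}
    (hs : Holds s w i j acc p W) (h6 : s.reg 6 = b) (h7 : s.reg 7 = q) (hb : b ≠ 0) (hW : W < w)
    (hW0 : 0 < W)
    (he : e = p + 3 * W + (i / b * q + j / b) * (3 * W)) (hel : e + 3 * W + 1 < 2 ^ w)
    (hptr : p + 3 * W + 3 * W * (q * q) + bitField D (e + W) W + 1 < 2 ^ w)
    (hacc : acc + bitField D e W < 2 ^ w) :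
    Holds (runAssigns w D gridStep s) w (i % b) (j % b) (acc + bitField D e W)
      (p + 3 * W + 3 * W * (q * q) + bitField D (e + W) W) (bitField D (e + (W + W)) W) := by
  obtain ⟨h0, h1, h2, h3, h4, h5⟩ := hs
  have hc : i / b * q + j / b ≤ (i / b * q + j / b) * (3 * W) := Nat.le_mul_of_pos_right _ (by omega)
  have hc' : i / b * q ≤ i / b * q + j / b := Nat.le_add_right _ _
  have hqq : q * q ≤ 3 * W * (q * q) := Nat.le_mul_of_pos_left _ (by omega)
  simp only [runAssigns, gridStep]
  have e1 : (Expr.op .mul (.lit 3) (.reg 5)).eval w D s = 3 * W :=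
    eval_mul (eval_lit (by omega)) h5 (by omega)
  rw [e1]
  set s1 := s.set 9 (3 * W) with hs1
  have e2 : (Expr.op .add (.reg 4) (.reg 9)).eval w D s1 = p + 3 * W :=
    eval_add (by simp [Expr.eval, hs1, State.set_reg, h4]) (by simp [Expr.eval, hs1, State.set_reg])
      (by omega)
  rw [e2]
  set s2 := s1.set 4 (p + 3 * W) with hs2
  have a0 : s2.reg 0 = i := by simp [hs2, hs1, State.set_reg, h0]
  have a1 : s2.reg 1 = j := by simp [hs2, hs1, State.set_reg, h1]
  have a2 : s2.reg 2 = w := by simp [hs2, hs1, State.set_reg, h2]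
  have a3 : s2.reg 3 = acc := by simp [hs2, hs1, State.set_reg, h3]
  have a4 : s2.reg 4 = p + 3 * W := by simp [hs2, State.set_reg]
  have a5 : s2.reg 5 = W := by simp [hs2, hs1, State.set_reg, h5]
  have a6 : s2.reg 6 = b := by simp [hs2, hs1, State.set_reg, h6]
  have a7 : s2.reg 7 = q := by simp [hs2, hs1, State.set_reg, h7]
  have a9 : s2.reg 9 = 3 * W := by simp [hs2, hs1, State.set_reg]
  have e3 : (Expr.op .add (.reg 4)
      (.op .mul (.op .add (.op .mul (.op .div (.reg 0) (.reg 6)) (.reg 7))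
        (.op .div (.reg 1) (.reg 6))) (.reg 9))).eval w D s2 = e := by
    rw [he]
    refine eval_add a4 (eval_mul (eval_add (eval_mul (eval_div a0 a6) a7 ?_) (eval_div a1 a6) ?_)
      a9 ?_) ?_ <;> omega
  rw [e3]
  set s3 := s2.set 8 e with hs3
  have e4 : (Expr.op .add (.reg 3) (readExpr (.reg 8) (.reg 5))).eval w D s3 =
      acc + bitField D e W := by
    refine eval_add (x := acc) ?_ (eval_readExpr (x := e) (y := W) ?_ ?_ ?_ ?_ hW) hacc
    · simp [Expr.eval, hs3, State.set_reg, a3]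
    · simp [Expr.eval, hs3, State.set_reg]
    · simp [Expr.eval, hs3, State.set_reg, a5]
    · simp [hs3, State.set_reg, a2]
    · omega
  rw [e4]
  set s4 := s3.set 3 (acc + bitField D e W) with hs4
  have b2 : s4.reg 2 = w := by simp [hs4, hs3, State.set_reg, a2]
  have b4 : s4.reg 4 = p + 3 * W := by simp [hs4, hs3, State.set_reg, a4]
  have b5 : s4.reg 5 = W := by simp [hs4, hs3, State.set_reg, a5]
  have b7 : s4.reg 7 = q := by simp [hs4, hs3, State.set_reg, a7]
  have b8 : s4.reg 8 = e := by simp [hs4, hs3, State.set_reg]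
  have b9 : s4.reg 9 = 3 * W := by simp [hs4, hs3, State.set_reg, a9]
  have e5 : (Expr.op .add (.op .add (.reg 4) (.op .mul (.reg 9) (.op .mul (.reg 7) (.reg 7))))
      (readExpr (.op .add (.reg 8) (.reg 5)) (.reg 5))).eval w D s4 =
      p + 3 * W + 3 * W * (q * q) + bitField D (e + W) W := by
    refine eval_add (eval_add b4 (eval_mul b9 (eval_mul b7 b7 ?_) ?_) ?_)
      (eval_readExpr (eval_add b8 b5 ?_) b5 b2 ?_ hW) ?_ <;> omega
  rw [e5]
  set P := p + 3 * W + 3 * W * (q * q) + bitField D (e + W) W with hP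
  set s5 := s4.set 4 P with hs5
  have e6 : (readExpr (.op .add (.reg 8) (.op .add (.reg 5) (.reg 5))) (.reg 5)).eval w D s5 =
      bitField D (e + (W + W)) W := by
    have c2 : s5.reg 2 = w := by simp [hs5, State.set_reg, b2]
    have c5 : s5.reg 5 = W := by simp [hs5, State.set_reg, b5]
    have c8 : s5.reg 8 = e := by simp [hs5, State.set_reg, b8]
    refine eval_readExpr (eval_add c8 (eval_add c5 c5 ?_) ?_) c5 c2 ?_ hW <;> omega
  rw [e6]
  set s6 := s5.set 5 (bitField D (e + (W + W)) W) with hs6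
  have d0 : s6.reg 0 = i := by simp [hs6, hs5, hs4, hs3, State.set_reg, a0]
  have d1 : s6.reg 1 = j := by simp [hs6, hs5, hs4, hs3, State.set_reg, a1]
  have d6 : s6.reg 6 = b := by simp [hs6, hs5, hs4, hs3, State.set_reg, a6]
  have e7 : (Expr.op .mod (.reg 0) (.reg 6)).eval w D s6 = i % b := eval_mod d0 d6 hb
  rw [e7]
  set s7 := s6.set 0 (i % b) with hs7
  have e8 : (Expr.op .mod (.reg 1) (.reg 6)).eval w D s7 = j % b := by
    refine eval_mod ?_ ?_ hb
    · simp [Expr.eval, hs7, State.set_reg, d1]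
    · simp [Expr.eval, hs7, State.set_reg, d6]
  rw [e8]
  refine ⟨?_, ?_, ?_, ?_, ?_, ?_⟩ <;>
    simp [hs7, hs6, hs5, hs4, hs3, State.set_reg, a2]

/-- The descent finds the located value. -/
theorem exec_descent {w K : ℕ} {D : List Bool} (hK : K < w) (hD : D.length + 1 < 2 ^ w)
    {h p W i j v : ℕ} (H : Located D K h p W i j v) :
    ∀ {acc : ℕ} {s : State}, Holds s w i j acc p W → acc + v < 2 ^ w →
      ∃ T s', T ≤ stepCost * (h + 1) ∧ Exec w D (.while (.reg 5) descendStep) s T s' ∧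
        s'.reg 3 = acc + v := by
  induction H with
  | done h p i j =>
    intro acc s hs _
    refine ⟨_, s, ?_, .while_false _ _ s (by simp [Expr.eval, hs.r5]), by simp [hs.r3]⟩
    have : 2 ≤ stepCost := by unfold stepCost; omega
    simp only [Expr.cost]
    nlinarith
  | grid h p W i j b q e v ptr W' z hW hKW hb0 hb hq he hv hptr hW' hl hl' hz ih =>
    intro acc s hs hacc
    obtain ⟨hs1, h6, h7⟩ := holds_loadNode (D := D) hs (by omega) (by
      have : p + W ≤ e := by rw [he]; omega
      omega)
    have hs2 := holds_gridStep (e := e) hs1 (h6.trans hb) (h7.trans hq) hb0 (by omega) hW he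
      (by omega) (by rw [hptr]; omega) (by rw [hv]; omega)
    rw [hv, hptr, hW'] at hs2
    obtain ⟨T, s', hT, hE, hr⟩ := ih hs2 (by omega)
    refine ⟨_, s', ?_, .while_true _ _ s _ s' _ _ (by simp [Expr.eval, hs.r5]; omega)
      (.seq _ _ _ _ _ _ _ (exec_assigns w D _ s) (.ite_true _ _ _ _ _ _ ?_
        (exec_assigns w D _ _))) hE, by rw [hr]; omega⟩
    · have : stepCost = 4 + assignsCost loadNode + assignsCost gridStep + assignsCost jumpStep := rfl
      simp only [Expr.cost]
      rw [mul_add, mul_one]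
      omega
    · simp only [Expr.eval, h6, hb]; exact hb0
  | jump h p W i j p' W' z hW hKW hb hp' hW' hl hl' hz ih =>
    intro acc s hs hacc
    obtain ⟨hs1, h6, h7⟩ := holds_loadNode (D := D) hs (by omega) (by omega)
    have hs2 := holds_jumpStep (D := D) hs1 (h7.trans hp') (by omega) (by omega)
    rw [hW'] at hs2
    obtain ⟨T, s', hT, hE, hr⟩ := ih hs2 (by omega)
    refine ⟨_, s', ?_, .while_true _ _ s _ s' _ _ (by simp [Expr.eval, hs.r5]; omega)
      (.seq _ _ _ _ _ _ _ (exec_assigns w D _ s) (.ite_false _ _ _ _ _ _ ?_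
        (exec_assigns w D _ _))) hE, hr⟩
    · have : stepCost = 4 + assignsCost loadNode + assignsCost gridStep + assignsCost jumpStep := rfl
      simp only [Expr.cost]
      rw [mul_add, mul_one]
      omega
    · simp only [Expr.eval, h6, hb]

/-! ### Decoding the header and the complete query. -/

/-- Reads the header of the data structure: a unary number `H`, followed by three fields of `H`
bits: the width of the root, the first value and the position of the root. -/
def loadHeader : List (ℕ × Expr) :=
  [(4, .data (.lit 0)),
   (5, .op .and (.reg 4) (.op .sub (.lit 0) (.reg 4))),
   (6, .op .div (.reg 4) (.op .mul (.reg 5) (.lit 2))),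
   (3, .op .mod (.op .div (.reg 6) (.reg 5)) (.reg 5)),
   (4, .op .mod (.op .div (.op .div (.reg 6) (.reg 5)) (.reg 5)) (.reg 5)),
   (5, .op .mod (.reg 6) (.reg 5))]

/-- Since `4 * H + 1 < w`, the whole header lies in the first word. The unary number makes `2 ^ H`
its lowest set bit; division by that bit acts as a shift and reduction modulo it as a mask. -/
theorem holds_loadHeader {w i j H : ℕ} {D : List Bool} (hH : 4 * H + 1 < w)
    (hD : bitField D 0 (H + 1) = 2 ^ H) (hi : i < 2 ^ w) (hj : j < 2 ^ w) :
    Holds (runAssigns w D loadHeader (State.init w i j)) w i j (bitField D (2 * H + 1) H)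
      (bitField D (3 * H + 1) H) (bitField D (H + 1) H) := by
  set x := bitField D 0 w with hx
  have hxw : x < 2 ^ w := bitField_lt _ _ _
  have hH0 : 0 < 2 ^ H := by positivity
  have hmod : x % 2 ^ (H + 1) = 2 ^ H := by
    have := bitField_div_mod D 0 w 0 (H + 1) (by omega)
    simpa [hD] using this
  have hx0 : 0 < x := by
    rcases Nat.eq_zero_or_pos x with h | h
    · rw [h] at hmod; simp at hmod; omega
    · exact h
  have hHw : 2 ^ H * 2 < 2 ^ w := by
    rw [← pow_succ]; exact Nat.pow_lt_pow_right (by norm_num) (by omega)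
  simp only [runAssigns, loadHeader]
  set s0 := State.init w i j with hs0
  have z0 : s0.reg 0 = i := by simp [hs0, State.init, Nat.mod_eq_of_lt hi]
  have z1 : s0.reg 1 = j := by simp [hs0, State.init, Nat.mod_eq_of_lt hj]
  have z2 : s0.reg 2 = w := by simp [hs0, State.init]
  have e1 : (Expr.data (.lit 0)).eval w D s0 = x := by
    simp only [Expr.eval, Nat.zero_mod]
    unfold dataWord
    rw [hx]; simp [bitField]
  rw [e1]
  set s1 := s0.set 4 x with hs1
  have e2 : (Expr.op .and (.reg 4) (.op .sub (.lit 0) (.reg 4))).eval w D s1 = 2 ^ H := by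
    have : s1.reg 4 = x := by simp [hs1, State.set_reg]
    simp only [Expr.eval, BinOp.eval, this, Nat.zero_mod, zero_add]
    rw [Nat.mod_eq_of_lt (by omega)]
    exact and_two_pow_sub x H w hmod hxw
  rw [e2]
  set s2 := s1.set 5 (2 ^ H) with hs2
  have e3 : (Expr.op .div (.reg 4) (.op .mul (.reg 5) (.lit 2))).eval w D s2 = x / (2 ^ H * 2) := by
    refine eval_div ?_ (eval_mul ?_ (eval_lit ?_) hHw)
    · simp [Expr.eval, hs2, hs1, State.set_reg]
    · simp [Expr.eval, hs2, State.set_reg]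
    · omega
  rw [e3]
  set s3 := s2.set 6 (x / (2 ^ H * 2)) with hs3
  have a5 : s3.reg 5 = 2 ^ H := by simp [hs3, hs2, State.set_reg]
  have a6 : s3.reg 6 = x / (2 ^ H * 2) := by simp [hs3, State.set_reg]
  have e4 : (Expr.op .mod (.op .div (.reg 6) (.reg 5)) (.reg 5)).eval w D s3 =
      bitField D (2 * H + 1) H := by
    rw [eval_mod (eval_div (eval_reg a6) (eval_reg a5)) (eval_reg a5) hH0.ne', Nat.div_div_eq_div_mul, ← pow_succ, ← pow_add,
      bitField_div_mod _ _ _ _ _ (by omega)]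
    congr 1; ring
  rw [e4]
  set s4 := s3.set 3 (bitField D (2 * H + 1) H) with hs4
  have b5 : s4.reg 5 = 2 ^ H := by simp [hs4, State.set_reg, a5]
  have b6 : s4.reg 6 = x / (2 ^ H * 2) := by simp [hs4, State.set_reg, a6]
  have e5 : (Expr.op .mod (.op .div (.op .div (.reg 6) (.reg 5)) (.reg 5)) (.reg 5)).eval w D s4 =
      bitField D (3 * H + 1) H := by
    rw [eval_mod (eval_div (eval_div (eval_reg b6) (eval_reg b5)) (eval_reg b5)) (eval_reg b5)
      hH0.ne', Nat.div_div_eq_div_mul,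
      Nat.div_div_eq_div_mul, ← pow_succ, ← pow_add, ← pow_add,
      bitField_div_mod _ _ _ _ _ (by omega)]
    congr 1; ring
  rw [e5]
  set s5 := s4.set 4 (bitField D (3 * H + 1) H) with hs5
  have c5 : s5.reg 5 = 2 ^ H := by simp [hs5, State.set_reg, b5]
  have c6 : s5.reg 6 = x / (2 ^ H * 2) := by simp [hs5, State.set_reg, b6]
  have e6 : (Expr.op .mod (.reg 6) (.reg 5)).eval w D s5 = bitField D (H + 1) H := by
    rw [eval_mod (eval_reg c6) (eval_reg c5) hH0.ne', ← pow_succ, bitField_div_mod _ _ _ _ _ (by omega)]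
    congr 1; ring
  rw [e6]
  refine ⟨?_, ?_, ?_, ?_, ?_, ?_⟩ <;>
    simp [hs5, hs4, hs3, hs2, hs1, State.set_reg, z0, z1, z2]

/-- The query program. -/
def queryProgram : Cmd :=
  .seq (assigns loadHeader) (.seq (.while (.reg 5) descendStep) (.assign 0 (.reg 3)))

/-- A bound for the cost of the query program, apart from the number of descent steps. -/
def queryCost : ℕ := stepCost + assignsCost loadHeader + 2

theorem answers_queryProgram {w K H i j h acc v : ℕ} {D : List Bool} (hK : K < w)
    (hlen : D.length + 1 < 2 ^ w) (hH : 4 * H + 1 < w) (hD : bitField D 0 (H + 1) = 2 ^ H)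
    (hi : i < 2 ^ w) (hj : j < 2 ^ w) (hacc : bitField D (2 * H + 1) H = acc)
    (hl : Located D K h (bitField D (3 * H + 1) H) (bitField D (H + 1) H) i j v)
    (hv : acc + v < 2 ^ w) : Answers w D queryProgram i j (acc + v) (queryCost * (h + 2)) := by
  have h1 := holds_loadHeader hH hD hi hj
  rw [hacc] at h1
  obtain ⟨T, s', hT, hE, hr⟩ := exec_descent hK hlen hl h1 hv
  refine ⟨_, _, ?_, .seq _ _ _ _ _ _ _ (exec_assigns w D _ _) (.seq _ _ _ _ _ _ _ hE
    (.assign _ _ _)), ?_⟩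
  · simp only [Expr.cost]
    unfold queryCost
    nlinarith
  · simp [Expr.eval, hr]

end WordRAM

/-! ### Trees of nested blocks -/

/-- The encoding of a grid node: a header with the side `b` of the children and the number `q` of
children per row, then for each child its offset value, its relative position and its field width,
then the encodings of the children. -/
def gridNode (W b q : ℕ) (v : ℕ → ℕ) (ch : ℕ → ℕ × List Bool) : List Bool :=
  -- The third field is padding: the header gets the length of a child entry, and of a jump node.
  natBits W b ++ (natBits W q ++ (natBits W 0 ++
    ((List.range (q * q)).flatMap (fun c => natBits W (v c) ++
      (natBits W (∑ c' ∈ Finset.range c, (ch c').2.length) ++ natBits W (ch c).1)) ++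
    (List.range (q * q)).flatMap fun c => (ch c).2)))

theorem length_gridNode (W b q : ℕ) (v : ℕ → ℕ) (ch : ℕ → ℕ × List Bool) :
    (gridNode W b q v ch).length =
      3 * W * (1 + q * q) + ∑ c ∈ Finset.range (q * q), (ch c).2.length := by
  simp only [gridNode, List.length_append, length_natBits, length_flatMap_range, Finset.sum_const,
    Finset.card_range, smul_eq_mul]
  ring

/-- All entries have equal length, so the entry of a child is found from its index; the prefix sum
stored there leads to an occurrence of the child's string. The child is assumed correct wherever its
string occurs, so the recursion tracks no absolute addresses. -/
theorem located_gridNode {D : List Bool} {K h p W b q i j z : ℕ} {v : ℕ → ℕ}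
    {ch : ℕ → ℕ × List Bool} (hO : Occ D p (gridNode W b q v ch)) (hp : p ≤ D.length)
    (hW : 0 < W) (hK : W ≤ K) (hb0 : b ≠ 0) (hb : b < 2 ^ W) (hq : q < 2 ^ W)
    (hv : ∀ c < q * q, v c < 2 ^ W) (hch : ∀ c < q * q, (ch c).1 < 2 ^ W)
    (hs : ∑ c ∈ Finset.range (q * q), (ch c).2.length < 2 ^ W) (hi : i < q * b) (hj : j < q * b)
    (hz : ∀ p', Occ D p' (ch (i / b * q + j / b)).2 → p' ≤ D.length →
      Located D K h p' (ch (i / b * q + j / b)).1 (i % b) (j % b) z) :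
    Located D K (h + 1) p W i j (v (i / b * q + j / b) + z) := by
  set c := i / b * q + j / b with hc
  have hib : i / b < q := (Nat.div_lt_iff_lt_mul (Nat.pos_of_ne_zero hb0)).2 hi
  have hjb : j / b < q := (Nat.div_lt_iff_lt_mul (Nat.pos_of_ne_zero hb0)).2 hj
  have hcq : c < q * q := by nlinarith
  have hlen := hO.length_le hp
  rw [length_gridNode] at hlen
  obtain ⟨o1, hO⟩ := occ_append hO
  obtain ⟨o2, hO⟩ := occ_append hO
  obtain ⟨o3, hO⟩ := occ_append hO
  obtain ⟨o4, o5⟩ := occ_append hO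
  simp only [length_natBits, length_flatMap_range, List.length_append, Finset.sum_const,
    Finset.card_range, smul_eq_mul] at o2 o3 o4 o5
  replace o4 := o4.flatMap_range c hcq
  replace o5 := o5.flatMap_range c hcq
  simp only [length_natBits, List.length_append, Finset.sum_const,
    Finset.card_range, smul_eq_mul] at o4
  obtain ⟨o6, o4⟩ := occ_append o4
  obtain ⟨o7, o8⟩ := occ_append o4
  simp only [length_natBits] at o7 o8
  have he : p + W + W + W + c * (W + (W + W)) = p + 3 * W + c * (3 * W) := by ring
  rw [he] at o6 o7 o8
  have hpre : ∑ c' ∈ Finset.range c, (ch c').2.length + (ch c).2.length ≤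
      ∑ c ∈ Finset.range (q * q), (ch c).2.length := by
    rw [← Finset.sum_range_succ]
    exact Finset.sum_le_sum_of_subset (Finset.range_mono hcq)
  have hcW : c * (3 * W) + 3 * W ≤ 3 * W * (q * q) := by
    have := Nat.mul_le_mul_right (3 * W) (Nat.succ_le_of_lt hcq)
    rw [Nat.succ_mul] at this
    linarith
  have hlen' : p + 3 * W + 3 * W * (q * q) + ∑ c ∈ Finset.range (q * q), (ch c).2.length ≤
      D.length := by
    rw [mul_add, mul_one] at hlen; omega
  refine .grid h p W i j b q _ (v c) (∑ c' ∈ Finset.range c, (ch c').2.length)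
    (ch c).1 z hW hK hb0 (o1.bitField hb) (o2.bitField hq) rfl
    (o6.bitField (hv c hcq)) (o7.bitField (by omega)) ?_ ?_ ?_ ?_
  · rw [← add_assoc]; exact o8.bitField (hch c hcq)
  · rw [← hc]; omega
  · omega
  · refine hz _ ?_ (by omega)
    convert o5 using 1
    ring

/-! ### Block differences and nested encodings. -/

/-- Monotonicity in both coordinates. -/
def Mono2 (f : ℕ → ℕ → ℕ) : Prop := ∀ ⦃i i' j j' : ℕ⦄, i ≤ i' → j ≤ j' → f i j ≤ f i' j'

/-- The difference of the values at the last and the first cell of the block `(X, Y)` of side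
`2 ^ s`. -/
def blockDiff (f : ℕ → ℕ → ℕ) (s X Y : ℕ) : ℕ :=
  f ((X + 1) * 2 ^ s - 1) ((Y + 1) * 2 ^ s - 1) - f (X * 2 ^ s) (Y * 2 ^ s)

/-- The field width of the node for the block `(X, Y)` of side `2 ^ s`, whose children have
encodings of total length `t`. -/
def nodeWidth (f : ℕ → ℕ → ℕ) (s X Y t : ℕ) : ℕ := Nat.size (2 ^ s + blockDiff f s X Y + t)

/-- The encoding of the block `(X, Y)` of side `2 ^ s`, as field width and bit string.  The sides of
the nested blocks are given by the list; the blocks of the last level are encoded by `leaf`. -/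
def enc (f : ℕ → ℕ → ℕ) (leaf : ℕ → ℕ → ℕ × List Bool) : List ℕ → ℕ → ℕ → ℕ → ℕ × List Bool
  | [], _, X, Y => leaf X Y
  | s' :: ss, s, X, Y =>
    -- A repeated level is skipped, so the minima and maxima used later as exponents may coincide
    -- with their neighbours.
    if s = s' then enc f leaf ss s' X Y
    else if blockDiff f s X Y = 0 then (0, [])
    else
      (nodeWidth f s X Y (∑ c ∈ Finset.range (2 ^ (s - s') * 2 ^ (s - s')),
        (enc f leaf ss s' (X * 2 ^ (s - s') + c / 2 ^ (s - s'))
          (Y * 2 ^ (s - s') + c % 2 ^ (s - s'))).2.length),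
      gridNode
        (nodeWidth f s X Y (∑ c ∈ Finset.range (2 ^ (s - s') * 2 ^ (s - s')),
          (enc f leaf ss s' (X * 2 ^ (s - s') + c / 2 ^ (s - s'))
            (Y * 2 ^ (s - s') + c % 2 ^ (s - s'))).2.length))
        (2 ^ s') (2 ^ (s - s'))
        (fun c => f ((X * 2 ^ (s - s') + c / 2 ^ (s - s')) * 2 ^ s')
          ((Y * 2 ^ (s - s') + c % 2 ^ (s - s')) * 2 ^ s') - f (X * 2 ^ s) (Y * 2 ^ s))
        (fun c => enc f leaf ss s' (X * 2 ^ (s - s') + c / 2 ^ (s - s'))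
          (Y * 2 ^ (s - s') + c % 2 ^ (s - s'))))

/-- The levels `s, ss` are non-increasing and end with `lv`. -/
def Levels (lv : ℕ) : ℕ → List ℕ → Prop
  | s, [] => s = lv
  | s, s' :: ss => s' ≤ s ∧ Levels lv s' ss

theorem block_index {s s' X x : ℕ} (h : s' ≤ s) :
    (X * 2 ^ (s - s') + x) * 2 ^ s' = X * 2 ^ s + x * 2 ^ s' := by
  rw [add_mul, mul_assoc, ← pow_add, Nat.sub_add_cancel h]

theorem block_index_le {s s' X x : ℕ} (h : s' ≤ s) (hx : x < 2 ^ (s - s')) :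
    (X * 2 ^ (s - s') + x + 1) * 2 ^ s' ≤ (X + 1) * 2 ^ s := by
  rw [add_assoc, block_index h, add_mul X, one_mul]
  have : (x + 1) * 2 ^ s' ≤ 2 ^ (s - s') * 2 ^ s' := Nat.mul_le_mul_right _ hx
  rw [← pow_add, Nat.sub_add_cancel h] at this
  omega

theorem blockDiff_child_le {f : ℕ → ℕ → ℕ} (hf : Mono2 f) {s s' X Y x y : ℕ} (h : s' ≤ s)
    (hx : x < 2 ^ (s - s')) (hy : y < 2 ^ (s - s')) :
    blockDiff f s' (X * 2 ^ (s - s') + x) (Y * 2 ^ (s - s') + y) ≤ blockDiff f s X Y := by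
  unfold blockDiff
  refine tsub_le_tsub (hf (Nat.sub_le_sub_right (block_index_le h hx) 1)
    (Nat.sub_le_sub_right (block_index_le h hy) 1)) (hf ?_ ?_) <;>
    · rw [block_index h]; omega

theorem mono2_sub_le_blockDiff {f : ℕ → ℕ → ℕ} (hf : Mono2 f) {s X Y i j : ℕ} (hi : i < 2 ^ s)
    (hj : j < 2 ^ s) :
    f (X * 2 ^ s + i) (Y * 2 ^ s + j) - f (X * 2 ^ s) (Y * 2 ^ s) ≤ blockDiff f s X Y := by
  unfold blockDiff
  refine Nat.sub_le_sub_right (hf ?_ ?_) _ <;>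
    · rw [add_mul, one_mul]; omega

theorem div_mod_lt_of_lt_mul {q c : ℕ} (hc : c < q * q) : c / q < q ∧ c % q < q := by
  have hq : 0 < q := by
    rcases Nat.eq_zero_or_pos q with h | h
    · simp [h] at hc
    · exact h
  exact ⟨(Nat.div_lt_iff_lt_mul hq).2 hc, Nat.mod_lt _ hq⟩

/-- The width of a child is stored in a field of its parent. Being at most the child's length, it is
covered by the total length of the children, for which the parent's fields are already wide enough.
-/
theorem fst_enc_le {f : ℕ → ℕ → ℕ} {leaf : ℕ → ℕ → ℕ × List Bool}
    (hleaf : ∀ X Y, (leaf X Y).1 ≤ (leaf X Y).2.length) :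
    ∀ (ss : List ℕ) (s X Y : ℕ), (enc f leaf ss s X Y).1 ≤ (enc f leaf ss s X Y).2.length
  | [], _, X, Y => hleaf X Y
  | s' :: ss, s, X, Y => by
    rw [enc]
    split_ifs
    · exact fst_enc_le hleaf ss s' X Y
    · simp
    · dsimp only
      rw [length_gridNode]
      generalize nodeWidth _ _ _ _ _ = W
      refine Nat.le_add_right_of_le ?_
      calc W = W * 1 := (mul_one W).symm
        _ ≤ W * (3 * (1 + 2 ^ (s - s') * 2 ^ (s - s'))) := Nat.mul_le_mul_left _ (by omega)
        _ = _ := by ring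

theorem size_le_self (d : ℕ) : d.size ≤ d := Nat.size_le.2 Nat.lt_two_pow_self

/-- The encoding of a block with leaves of polynomial size has polynomial size, and its field width
is logarithmic. -/
theorem length_enc_le {f : ℕ → ℕ → ℕ} (hf : Mono2 f) {leaf : ℕ → ℕ → ℕ × List Bool} {κ lv : ℕ}
    (hκ : 8 * κ + 40 ≤ 2 ^ κ)
    (hleaf : ∀ X Y, (leaf X Y).2.length ≤ 2 ^ κ * 16 ^ lv * blockDiff f lv X Y) :
    ∀ (ss : List ℕ) (s X Y : ℕ), Levels lv s ss →
      (enc f leaf ss s X Y).2.length ≤ 2 ^ κ * 16 ^ s * blockDiff f s X Y ∧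
      ∀ s' ss', ss = s' :: ss' → s ≠ s' → blockDiff f s X Y ≠ 0 →
        (enc f leaf ss s X Y).1 ≤ κ + 4 * s + (blockDiff f s X Y).size
  | [], s, X, Y, h => by
    cases h
    exact ⟨hleaf X Y, by simp⟩
  | s' :: ss, s, X, Y, h => by
    by_cases hs : s = s'
    · subst hs
      rw [enc, if_pos rfl]
      refine ⟨(length_enc_le hf hκ hleaf ss s X Y h.2).1, ?_⟩
      rintro s' ss' h hs
      simp at h
      exact absurd h.1 hs
    by_cases hd : blockDiff f s X Y = 0
    · rw [enc, if_neg hs, if_pos hd]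
      exact ⟨by simp, fun _ _ _ _ h => absurd hd h⟩
    rw [enc, if_neg hs, if_neg hd]
    dsimp only
    rw [length_gridNode]
    have hlt : s' < s := lt_of_le_of_ne h.1 (Ne.symm hs)
    set d := blockDiff f s X Y with hdd
    set t := s - s' with ht
    set S := ∑ c ∈ Finset.range (2 ^ t * 2 ^ t),
        (enc f leaf ss s' (X * 2 ^ t + c / 2 ^ t) (Y * 2 ^ t + c % 2 ^ t)).2.length with hS
    have hd1 : 1 ≤ d := Nat.one_le_iff_ne_zero.2 hd
    have hS1 : S ≤ (2 ^ t * 2 ^ t) * (2 ^ κ * 16 ^ s' * d) := by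
      rw [hS]
      refine (Finset.sum_le_card_nsmul _ _ (2 ^ κ * 16 ^ s' * d) fun c hc => ?_).trans (by simp)
      obtain ⟨hx, hy⟩ := div_mod_lt_of_lt_mul (Finset.mem_range.1 hc)
      exact (length_enc_le hf hκ hleaf ss s' _ _ h.2).1.trans
        (Nat.mul_le_mul_left _ (blockDiff_child_le hf h.1 hx hy))
    have h4t : (2 ^ t * 2 ^ t : ℕ) = 4 ^ t := by rw [← mul_pow]; norm_num
    have h16 : (16 : ℕ) ^ s = 16 ^ s' * (4 ^ t * 4 ^ t) := by
      rw [← mul_pow, show 4 * 4 = 16 by norm_num, ← pow_add]; congr 1; omega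
    have h4 : 4 ≤ 4 ^ t := by
      calc 4 = 4 ^ 1 := rfl
        _ ≤ 4 ^ t := Nat.pow_le_pow_right (by norm_num) (by omega)
    set B := 2 ^ κ * 16 ^ s * d with hB
    -- Each of the `4 ^ t` children has a bound smaller by `16 ^ t`, so together they use at most `B
    -- / 4 ^ t ≤ B / 4`. The node itself may use the other `3 * B / 4`.
    have hSB : 4 * S ≤ B := by
      have : B = (4 ^ t) * (4 ^ t * (2 ^ κ * 16 ^ s' * d)) := by rw [hB, h16]; ring
      rw [this]
      rw [h4t] at hS1
      exact Nat.mul_le_mul h4 hS1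
    have h4s : s + 1 ≤ 4 ^ s := Nat.lt_pow_self (by norm_num)
    have hB' : B = 2 ^ κ * (4 ^ s * (4 ^ s * d)) := by
      rw [hB, show (16 : ℕ) = 4 * 4 by norm_num, mul_pow]; ring
    set u := 4 ^ s * d with hu
    have hu1 : d ≤ u := Nat.le_mul_of_pos_left _ (by positivity)
    have hu2 : 4 ^ s ≤ u := Nat.le_mul_of_pos_right _ hd1
    have hκ' : 40 ≤ 2 ^ κ := by omega
    have huB : 4 * (2 ^ s + d) ≤ 3 * B := by
      have h1 : 2 ^ s ≤ 4 ^ s := Nat.pow_le_pow_left (by norm_num) s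
      have h2 : u ≤ 4 ^ s * u := Nat.le_mul_of_pos_left _ (by positivity)
      have h3 : 40 * (4 ^ s * u) ≤ B := by rw [hB']; exact Nat.mul_le_mul_right _ hκ'
      omega
    have hWle : nodeWidth f s X Y S ≤ κ + 4 * s + d.size := by
      rw [nodeWidth, Nat.size_le]
      refine lt_of_le_of_lt (b := B) (by omega) ?_
      rw [hB, pow_add, pow_add, pow_mul]
      exact Nat.mul_lt_mul_of_pos_left (Nat.lt_size_self d) (by positivity)
    refine ⟨?_, fun _ _ _ _ _ => hWle⟩
    generalize nodeWidth f s X Y S = W at hWle ⊢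
    rw [h4t]
    have hsz := size_le_self d
    -- Header and entries take `3 * W * (1 + 4 ^ t) ≤ 6 * W * 4 ^ t` bits, so it suffices that `8 *
    -- W * 4 ^ t ≤ B`.
    have hW8 : 8 * W ≤ 2 ^ κ * u := by
      have : (8 * κ + 40) * u ≤ 2 ^ κ * u := Nat.mul_le_mul_right _ hκ
      have : κ ≤ κ * u := Nat.le_mul_of_pos_right _ (by omega)
      nlinarith
    have h5 : 4 ^ t ≤ 4 ^ s := Nat.pow_le_pow_right (by norm_num) (by omega)
    have h6 : 8 * W * 4 ^ t ≤ B := by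
      rw [hB']
      calc 8 * W * 4 ^ t ≤ 2 ^ κ * u * 4 ^ s := Nat.mul_le_mul hW8 h5
        _ = _ := by ring
    have h7 : W ≤ W * 4 ^ t := Nat.le_mul_of_pos_right _ (by positivity)
    have h8 : 3 * W * (1 + 4 ^ t) = 3 * W + 3 * (W * 4 ^ t) := by ring
    have h9 : 8 * W * 4 ^ t = 8 * (W * 4 ^ t) := by ring
    omega

/-- The encoding of a block determines the values in the block. -/
theorem located_enc {f : ℕ → ℕ → ℕ} (hf : Mono2 f) {leaf : ℕ → ℕ → ℕ × List Bool} {κ lv K h M : ℕ}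
    {D : List Bool} (hκ : 8 * κ + 40 ≤ 2 ^ κ) (hM : ∀ i j, f i j ≤ M)
    (hleaf : ∀ X Y, (leaf X Y).2.length ≤ 2 ^ κ * 16 ^ lv * blockDiff f lv X Y)
    (hfst : ∀ X Y, (leaf X Y).1 ≤ (leaf X Y).2.length)
    (hloc : ∀ X Y p, Occ D p (leaf X Y).2 → p ≤ D.length → ∀ i < 2 ^ lv, ∀ j < 2 ^ lv,
      Located D K h p (leaf X Y).1 i j
        (f (X * 2 ^ lv + i) (Y * 2 ^ lv + j) - f (X * 2 ^ lv) (Y * 2 ^ lv))) :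
    ∀ (ss : List ℕ) (s X Y p : ℕ), Levels lv s ss → κ + 4 * s + M.size ≤ K →
      Occ D p (enc f leaf ss s X Y).2 → p ≤ D.length → ∀ i < 2 ^ s, ∀ j < 2 ^ s,
        Located D K (h + ss.length) p (enc f leaf ss s X Y).1 i j
          (f (X * 2 ^ s + i) (Y * 2 ^ s + j) - f (X * 2 ^ s) (Y * 2 ^ s))
  | [], s, X, Y, p, hl, _, hO, hp, i, hi, j, hj => by
    cases hl
    exact hloc X Y p hO hp i hi j hj
  | s' :: ss, s, X, Y, p, hl, hK, hO, hp, i, hi, j, hj => by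
    have hW := (length_enc_le hf hκ hleaf (s' :: ss) s X Y hl).2 s' ss rfl
    by_cases hs : s = s'
    · subst hs
      rw [enc, if_pos rfl] at hO ⊢
      exact (located_enc hf hκ hM hleaf hfst hloc ss s X Y p hl.2 hK hO hp i hi j hj).mono
        (by simp)
    by_cases hd : blockDiff f s X Y = 0
    · rw [enc, if_neg hs, if_pos hd]
      have := mono2_sub_le_blockDiff hf (X := X) (Y := Y) hi hj
      rw [hd, Nat.le_zero] at this
      rw [this]
      exact .done ..
    replace hW := hW hs hd
    rw [enc, if_neg hs, if_neg hd] at hO hW ⊢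
    dsimp only at hO hW ⊢
    have hlt : s' < s := lt_of_le_of_ne hl.1 (Ne.symm hs)
    set t := s - s' with ht
    set S := ∑ c ∈ Finset.range (2 ^ t * 2 ^ t),
        (enc f leaf ss s' (X * 2 ^ t + c / 2 ^ t) (Y * 2 ^ t + c % 2 ^ t)).2.length with hS
    have hdM : blockDiff f s X Y ≤ M := (Nat.sub_le _ _).trans (hM _ _)
    have hsz : 2 ^ s + blockDiff f s X Y + S < 2 ^ nodeWidth f s X Y S := Nat.lt_size_self _
    have hWK : nodeWidth f s X Y S ≤ K := hW.trans
      ((Nat.add_le_add_left (Nat.size_le_size hdM) _).trans hK)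
    generalize nodeWidth f s X Y S = W at hO hsz hWK ⊢
    have hts : 2 ^ t * 2 ^ s' = 2 ^ s := by rw [← pow_add]; congr 1; omega
    have hb0 : 0 < 2 ^ s' := by positivity
    have hq0 : 0 < 2 ^ t := by positivity
    have hb : 2 ^ s' ≤ 2 ^ s := Nat.pow_le_pow_right (by norm_num) hl.1
    have hq : 2 ^ t ≤ 2 ^ s := Nat.pow_le_pow_right (by norm_num) (by omega)
    have hib : i / 2 ^ s' < 2 ^ t := (Nat.div_lt_iff_lt_mul hb0).2 (by rw [hts]; exact hi)
    have hjb : j / 2 ^ s' < 2 ^ t := (Nat.div_lt_iff_lt_mul hb0).2 (by rw [hts]; exact hj)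
    have hc1 : (i / 2 ^ s' * 2 ^ t + j / 2 ^ s') / 2 ^ t = i / 2 ^ s' := by
      rw [mul_comm, Nat.mul_add_div hq0, Nat.div_eq_of_lt hjb, add_zero]
    have hc2 : (i / 2 ^ s' * 2 ^ t + j / 2 ^ s') % 2 ^ t = j / 2 ^ s' := by
      rw [mul_comm, Nat.mul_add_mod, Nat.mod_eq_of_lt hjb]
    have hix : (X * 2 ^ t + i / 2 ^ s') * 2 ^ s' + i % 2 ^ s' = X * 2 ^ s + i := by
      rw [block_index hl.1, add_assoc, Nat.div_add_mod']
    have hjy : (Y * 2 ^ t + j / 2 ^ s') * 2 ^ s' + j % 2 ^ s' = Y * 2 ^ s + j := by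
      rw [block_index hl.1, add_assoc, Nat.div_add_mod']
    have key := located_gridNode (K := K) (h := h + ss.length) (i := i) (j := j)
      (z := f (X * 2 ^ s + i) (Y * 2 ^ s + j) - f ((X * 2 ^ t + i / 2 ^ s') * 2 ^ s')
        ((Y * 2 ^ t + j / 2 ^ s') * 2 ^ s')) hO hp ?_ hWK hb0.ne' ?_ ?_ ?_ ?_ ?_ ?_ ?_ ?_
    · refine Eq.subst (motive := fun v => Located D K (h + (ss.length + 1)) p W i j v) ?_ key
      rw [hc1, hc2]
      have h1 : f ((X * 2 ^ t + i / 2 ^ s') * 2 ^ s') ((Y * 2 ^ t + j / 2 ^ s') * 2 ^ s') ≤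
          f (X * 2 ^ s + i) (Y * 2 ^ s + j) := by
        rw [← hix, ← hjy]
        exact hf (Nat.le_add_right _ _) (Nat.le_add_right _ _)
      have h2 : f (X * 2 ^ s) (Y * 2 ^ s) ≤
          f ((X * 2 ^ t + i / 2 ^ s') * 2 ^ s') ((Y * 2 ^ t + j / 2 ^ s') * 2 ^ s') := by
        refine hf ?_ ?_ <;>
          · rw [block_index hl.1]; omega
      omega
    · by_contra hW0
      rw [Nat.eq_zero_of_not_pos hW0, pow_zero] at hsz
      have : 0 < 2 ^ s := by positivity
      omega
    · omega
    · omega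
    · intro c hc
      obtain ⟨hx, hy⟩ := div_mod_lt_of_lt_mul hc
      refine lt_of_le_of_lt (b := blockDiff f s X Y) ?_ (by omega)
      refine Nat.sub_le_sub_right (hf ?_ ?_) _
      · have := block_index_le (X := X) hl.1 hx
        rw [← ht, add_mul _ 1] at this
        omega
      · have := block_index_le (X := Y) hl.1 hy
        rw [← ht, add_mul _ 1] at this
        omega
    · intro c hc
      refine lt_of_le_of_lt (b := S) ((fst_enc_le hfst _ _ _ _).trans ?_) (by omega)
      exact Finset.single_le_sum (f := fun c => (enc f leaf ss s' (X * 2 ^ t + c / 2 ^ t)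
        (Y * 2 ^ t + c % 2 ^ t)).2.length) (fun _ _ => Nat.zero_le _) (Finset.mem_range.2 hc)
    · omega
    · rw [hts]; exact hi
    · rw [hts]; exact hj
    · intro p' hO' hp'
      rw [hc1, hc2] at hO' ⊢
      have := located_enc hf hκ hM hleaf hfst hloc ss s' (X * 2 ^ t + i / 2 ^ s')
        (Y * 2 ^ t + j / 2 ^ s') p' hl.2 (by omega) hO' hp' (i % 2 ^ s') (Nat.mod_lt _ hb0)
        (j % 2 ^ s') (Nat.mod_lt _ hb0)
      rwa [hix, hjy] at this

/-! ### The total size of the encodings -/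

/-- The total length of the encodings of all blocks of side `2 ^ s` in the square of side
`2 ^ e`. -/
def totalLength (f : ℕ → ℕ → ℕ) (leaf : ℕ → ℕ → ℕ × List Bool) (e : ℕ) (ss : List ℕ) (s : ℕ) : ℕ :=
  ∑ X ∈ Finset.range (2 ^ (e - s)), ∑ Y ∈ Finset.range (2 ^ (e - s)),
    (enc f leaf ss s X Y).2.length

theorem sum_range_mul_eq (N q : ℕ) (h : ℕ → ℕ) :
    ∑ X ∈ Finset.range (N * q), h X =
      ∑ x ∈ Finset.range N, ∑ y ∈ Finset.range q, h (x * q + y) := by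
  induction N with
  | zero => simp
  | succ N ih => rw [Nat.succ_mul, Finset.sum_range_add, ih, Finset.sum_range_succ]

theorem sum_subblocks (N q : ℕ) (g : ℕ → ℕ → ℕ) :
    ∑ X ∈ Finset.range N, ∑ Y ∈ Finset.range N, ∑ c ∈ Finset.range (q * q),
        g (X * q + c / q) (Y * q + c % q) =
      ∑ X ∈ Finset.range (N * q), ∑ Y ∈ Finset.range (N * q), g X Y := by
  rw [sum_range_mul_eq]
  refine Finset.sum_congr rfl fun X _ => ?_
  have : ∀ Y, ∑ c ∈ Finset.range (q * q), g (X * q + c / q) (Y * q + c % q) =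
      ∑ x ∈ Finset.range q, ∑ y ∈ Finset.range q, g (X * q + x) (Y * q + y) := by
    intro Y
    rw [sum_range_mul_eq]
    refine Finset.sum_congr rfl fun x _ => Finset.sum_congr rfl fun y hy => ?_
    have hy := Finset.mem_range.1 hy
    rw [mul_comm x q, Nat.mul_add_div (by omega), Nat.div_eq_of_lt hy, add_zero, Nat.mul_add_mod,
      Nat.mod_eq_of_lt hy]
  simp only [this]
  rw [Finset.sum_comm]
  refine Finset.sum_congr rfl fun x _ => ?_
  rw [sum_range_mul_eq]

/-- The blocks of one level have small total difference. -/
theorem sum_blockDiff_le {f : ℕ → ℕ → ℕ} (hf : Mono2 f) {M : ℕ} (hM : ∀ i j, f i j ≤ M) (s N : ℕ) :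
    ∑ X ∈ Finset.range N, ∑ Y ∈ Finset.range N, blockDiff f s X Y ≤ 2 * N * M := by
  set g : ℕ → ℕ → ℕ := fun X Y => f (X * 2 ^ s) (Y * 2 ^ s) with hg
  have hgm : Mono2 g := fun i i' j j' hi hj =>
    hf (Nat.mul_le_mul_right _ hi) (Nat.mul_le_mul_right _ hj)
  have h1 : ∀ X Y, blockDiff f s X Y ≤ (g (X + 1) (Y + 1) - g X (Y + 1)) +
      (g X (Y + 1) - g X Y) := by
    intro X Y
    rw [tsub_add_tsub_cancel (hgm (by omega) le_rfl) (hgm le_rfl (by omega))]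
    exact Nat.sub_le_sub_right (hf (Nat.sub_le _ _) (Nat.sub_le _ _)) _
  have h2 : ∑ X ∈ Finset.range N, ∑ Y ∈ Finset.range N, (g (X + 1) (Y + 1) - g X (Y + 1)) ≤
      N * M := by
    rw [Finset.sum_comm]
    refine (Finset.sum_le_card_nsmul _ _ M fun Y _ => ?_).trans (by simp)
    rw [Finset.sum_range_tsub (f := fun X => g X (Y + 1)) (fun a b h => hgm h le_rfl)]
    exact (Nat.sub_le _ _).trans (hM _ _)
  have h3 : ∑ X ∈ Finset.range N, ∑ Y ∈ Finset.range N, (g X (Y + 1) - g X Y) ≤ N * M := by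
    refine (Finset.sum_le_card_nsmul _ _ M fun X _ => ?_).trans (by simp)
    rw [Finset.sum_range_tsub (f := fun Y => g X Y) (fun a b h => hgm le_rfl h)]
    exact (Nat.sub_le _ _).trans (hM _ _)
  calc _ ≤ ∑ X ∈ Finset.range N, ∑ Y ∈ Finset.range N, ((g (X + 1) (Y + 1) - g X (Y + 1)) +
      (g X (Y + 1) - g X Y)) :=
        Finset.sum_le_sum fun X _ => Finset.sum_le_sum fun Y _ => h1 X Y
    _ = _ := by simp only [Finset.sum_add_distrib]
    _ ≤ N * M + N * M := Nat.add_le_add h2 h3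
    _ = 2 * N * M := by ring

/-- Trades a logarithm for a term linear in `d`, so that field widths can be summed over a level
through the total difference. -/
theorem size_le_add_div (s d : ℕ) : d.size ≤ s + d / 2 ^ s := by
  rw [Nat.size_le, pow_add]
  calc d < 2 ^ s * (d / 2 ^ s + 1) := Nat.lt_mul_div_succ d (by positivity)
    _ ≤ 2 ^ s * 2 ^ (d / 2 ^ s) := Nat.mul_le_mul_left _ Nat.lt_two_pow_self

/-! ### The cost of passing from one level to the next. -/

section Steps

variable {f : ℕ → ℕ → ℕ} {leaf : ℕ → ℕ → ℕ × List Bool} {κ lv : ℕ}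

theorem length_enc_cons_le (hf : Mono2 f) (hκ : 8 * κ + 40 ≤ 2 ^ κ)
    (hleaf : ∀ X Y, (leaf X Y).2.length ≤ 2 ^ κ * 16 ^ lv * blockDiff f lv X Y)
    {s s' : ℕ} {ss : List ℕ} (hl : Levels lv s (s' :: ss)) (hne : s ≠ s') (X Y : ℕ) :
    (enc f leaf (s' :: ss) s X Y).2.length ≤ (if blockDiff f s X Y = 0 then 0 else
        6 * 4 ^ (s - s') * (κ + 4 * s + (blockDiff f s X Y).size)) +
      ∑ c ∈ Finset.range (2 ^ (s - s') * 2 ^ (s - s')),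
        (enc f leaf ss s' (X * 2 ^ (s - s') + c / 2 ^ (s - s'))
          (Y * 2 ^ (s - s') + c % 2 ^ (s - s'))).2.length := by
  have hW := (length_enc_le hf hκ hleaf (s' :: ss) s X Y hl).2 s' ss rfl hne
  by_cases hd : blockDiff f s X Y = 0
  · rw [enc, if_neg hne, if_pos hd]; simp
  replace hW := hW hd
  rw [if_neg hd]
  rw [enc, if_neg hne, if_neg hd] at hW ⊢
  dsimp only at hW ⊢
  rw [length_gridNode]
  generalize nodeWidth _ _ _ _ _ = W at hW ⊢
  refine Nat.add_le_add_right ?_ _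
  have h4t : (2 ^ (s - s') * 2 ^ (s - s') : ℕ) = 4 ^ (s - s') := by rw [← mul_pow]; norm_num
  rw [h4t]
  have h1 : 1 ≤ 4 ^ (s - s') := Nat.one_le_pow _ _ (by norm_num)
  calc 3 * W * (1 + 4 ^ (s - s')) ≤ 3 * W * (2 * 4 ^ (s - s')) := Nat.mul_le_mul_left _ (by omega)
    _ = 6 * 4 ^ (s - s') * W := by ring
    _ ≤ _ := Nat.mul_le_mul_left _ hW

/-- The children of all blocks of one level are exactly the blocks of the next. Only an inequality
holds because constant blocks omit their subtrees. -/
theorem totalLength_cons_le (hf : Mono2 f) (hκ : 8 * κ + 40 ≤ 2 ^ κ)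
    (hleaf : ∀ X Y, (leaf X Y).2.length ≤ 2 ^ κ * 16 ^ lv * blockDiff f lv X Y)
    {e s s' : ℕ} {ss : List ℕ} (hl : Levels lv s (s' :: ss)) (hs : s ≤ e) (hne : s ≠ s') :
    totalLength f leaf e (s' :: ss) s ≤ (∑ X ∈ Finset.range (2 ^ (e - s)),
      ∑ Y ∈ Finset.range (2 ^ (e - s)), if blockDiff f s X Y = 0 then 0 else
        6 * 4 ^ (s - s') * (κ + 4 * s + (blockDiff f s X Y).size)) + totalLength f leaf e ss s' := by
  have h1 : 2 ^ (e - s') = 2 ^ (e - s) * 2 ^ (s - s') := by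
    have := hl.1
    rw [← pow_add]; congr 1; omega
  rw [totalLength, totalLength, h1, ← sum_subblocks]
  simp only [← Finset.sum_add_distrib]
  exact Finset.sum_le_sum fun X _ => Finset.sum_le_sum fun Y _ =>
    length_enc_cons_le hf hκ hleaf hl hne X Y

/-- The cost of a level, estimated through the number of all blocks. -/
theorem totalLength_cons_le_of_dense (hf : Mono2 f) {M : ℕ} (hM : ∀ i j, f i j ≤ M)
    (hκ : 8 * κ + 40 ≤ 2 ^ κ)
    (hleaf : ∀ X Y, (leaf X Y).2.length ≤ 2 ^ κ * 16 ^ lv * blockDiff f lv X Y)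
    {e s s' C : ℕ} {ss : List ℕ} (hl : Levels lv s (s' :: ss)) (hs : s ≤ e)
    (hC : s ≠ s' → 6 * (4 ^ e * (κ + 5 * s) + 2 * 2 ^ e * M) ≤ C * 4 ^ s') :
    totalLength f leaf e (s' :: ss) s ≤ C + totalLength f leaf e ss s' := by
  by_cases hne : s = s'
  · subst hne
    simp only [totalLength]
    refine Nat.le_add_left_of_le (Finset.sum_le_sum fun X _ => Finset.sum_le_sum fun Y _ => ?_)
    rw [enc, if_pos rfl]
  refine (totalLength_cons_le hf hκ hleaf hl hs hne).trans (Nat.add_le_add_right ?_ _)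
  set N := 2 ^ (e - s) with hN
  set q := 4 ^ (s - s') with hq
  have hNs : N * 2 ^ s = 2 ^ e := by rw [← pow_add]; congr 1; omega
  have hqs : q * 4 ^ s' = 4 ^ s := by
    have := hl.1
    rw [← pow_add]; congr 1; omega
  have h22 : ∀ t, (4 : ℕ) ^ t = 2 ^ t * 2 ^ t := fun t => by rw [← mul_pow]; norm_num
  -- The factor `2 ^ s` clears the denominator in the bound `s + d / 2 ^ s` for the size of a
  -- difference `d`.
  have h1 : 2 ^ s * ∑ X ∈ Finset.range N, ∑ Y ∈ Finset.range N, (if blockDiff f s X Y = 0 then 0 else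
      6 * q * (κ + 4 * s + (blockDiff f s X Y).size)) ≤
      6 * q * (2 ^ s * (N * N * (κ + 5 * s)) + 2 * N * M) := by
    have h2 : ∀ X Y, 2 ^ s * (if blockDiff f s X Y = 0 then 0 else
      6 * q * (κ + 4 * s + (blockDiff f s X Y).size)) ≤
        6 * q * (2 ^ s * (κ + 5 * s)) + 6 * q * blockDiff f s X Y := by
      intro X Y
      split_ifs with h
      · simp
      · have h3 := size_le_add_div s (blockDiff f s X Y)
        have h4 := Nat.mul_div_le (blockDiff f s X Y) (2 ^ s)
        calc 2 ^ s * (6 * q * (κ + 4 * s + (blockDiff f s X Y).size))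
            ≤ 2 ^ s * (6 * q * (κ + 4 * s + (s + blockDiff f s X Y / 2 ^ s))) := by gcongr
          _ = 6 * q * (2 ^ s * (κ + 5 * s)) + 6 * q * (2 ^ s * (blockDiff f s X Y / 2 ^ s)) := by ring
          _ ≤ _ := by gcongr
    simp only [Finset.mul_sum]
    calc _ ≤ ∑ X ∈ Finset.range N, ∑ Y ∈ Finset.range N,
          (6 * q * (2 ^ s * (κ + 5 * s)) + 6 * q * blockDiff f s X Y) :=
          Finset.sum_le_sum fun X _ => Finset.sum_le_sum fun Y _ => h2 X Y
      _ = N * (N * (6 * q * (2 ^ s * (κ + 5 * s)))) +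
          6 * q * ∑ X ∈ Finset.range N, ∑ Y ∈ Finset.range N, blockDiff f s X Y := by
          simp only [Finset.sum_add_distrib, Finset.sum_const, Finset.card_range, smul_eq_mul,
            Finset.mul_sum]
      _ ≤ N * (N * (6 * q * (2 ^ s * (κ + 5 * s)))) + 6 * q * (2 * N * M) := by
          gcongr; exact sum_blockDiff_le hf hM s N
      _ = _ := by ring
  set LC := ∑ X ∈ Finset.range N, ∑ Y ∈ Finset.range N, (if blockDiff f s X Y = 0 then 0 else
      6 * q * (κ + 4 * s + (blockDiff f s X Y).size)) with hLC
  have h5 : LC * 4 ^ s ≤ C * 4 ^ s := by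
    calc LC * 4 ^ s = 2 ^ s * (2 ^ s * LC) := by rw [h22]; ring
      _ ≤ 2 ^ s * (6 * q * (2 ^ s * (N * N * (κ + 5 * s)) + 2 * N * M)) := Nat.mul_le_mul_left _ h1
      _ = q * (6 * ((N * 2 ^ s) * (N * 2 ^ s) * (κ + 5 * s) + 2 * (N * 2 ^ s) * M)) := by ring
      _ = q * (6 * (4 ^ e * (κ + 5 * s) + 2 * 2 ^ e * M)) := by rw [hNs, h22 e]
      _ ≤ q * (C * 4 ^ s') := Nat.mul_le_mul_left _ (hC hne)
      _ = C * 4 ^ s := by rw [← hqs]; ring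
  exact Nat.le_of_mul_le_mul_right h5 (by positivity)

/-- The cost of a level, estimated through the total difference of its blocks. -/
theorem totalLength_cons_le_of_sparse (hf : Mono2 f) {M : ℕ} (hM : ∀ i j, f i j ≤ M)
    (hκ : 8 * κ + 40 ≤ 2 ^ κ)
    (hleaf : ∀ X Y, (leaf X Y).2.length ≤ 2 ^ κ * 16 ^ lv * blockDiff f lv X Y)
    {e s s' C : ℕ} {ss : List ℕ} (hl : Levels lv s (s' :: ss)) (hs : s ≤ e)
    (hC : s ≠ s' → 12 * 4 ^ (s - s') * (κ + 4 * s + 1) * 2 ^ e * M ≤ C * 2 ^ s) :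
    totalLength f leaf e (s' :: ss) s ≤ C + totalLength f leaf e ss s' := by
  by_cases hne : s = s'
  · subst hne
    simp only [totalLength]
    refine Nat.le_add_left_of_le (Finset.sum_le_sum fun X _ => Finset.sum_le_sum fun Y _ => ?_)
    rw [enc, if_pos rfl]
  refine (totalLength_cons_le hf hκ hleaf hl hs hne).trans (Nat.add_le_add_right ?_ _)
  set N := 2 ^ (e - s) with hN
  set q := 4 ^ (s - s') with hq
  have hNs : N * 2 ^ s = 2 ^ e := by rw [← pow_add]; congr 1; omega
  have h2 : ∀ X Y, (if blockDiff f s X Y = 0 then 0 else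
      6 * q * (κ + 4 * s + (blockDiff f s X Y).size)) ≤
        6 * q * (κ + 4 * s + 1) * blockDiff f s X Y := by
    intro X Y
    split_ifs with h
    · simp
    · have h3 := size_le_self (blockDiff f s X Y)
      have h4 : (κ + 4 * s) * 1 ≤ (κ + 4 * s) * blockDiff f s X Y :=
        Nat.mul_le_mul_left _ (Nat.one_le_iff_ne_zero.2 h)
      rw [mul_assoc (6 * q)]
      refine Nat.mul_le_mul_left _ ?_
      rw [add_mul _ 1, one_mul]
      omega
  have h1 : ∑ X ∈ Finset.range N, ∑ Y ∈ Finset.range N, (if blockDiff f s X Y = 0 then 0 else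
      6 * q * (κ + 4 * s + (blockDiff f s X Y).size)) ≤
      6 * q * (κ + 4 * s + 1) * (2 * N * M) := by
    calc _ ≤ ∑ X ∈ Finset.range N, ∑ Y ∈ Finset.range N,
          6 * q * (κ + 4 * s + 1) * blockDiff f s X Y :=
          Finset.sum_le_sum fun X _ => Finset.sum_le_sum fun Y _ => h2 X Y
      _ = 6 * q * (κ + 4 * s + 1) * ∑ X ∈ Finset.range N, ∑ Y ∈ Finset.range N, blockDiff f s X Y := by
          simp only [Finset.mul_sum]
      _ ≤ _ := by gcongr; exact sum_blockDiff_le hf hM s N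
  refine Nat.le_of_mul_le_mul_right (c := 2 ^ s) ?_ (by positivity)
  calc _ ≤ 6 * q * (κ + 4 * s + 1) * (2 * N * M) * 2 ^ s := Nat.mul_le_mul_right _ h1
    _ = 12 * q * (κ + 4 * s + 1) * (N * 2 ^ s) * M := by ring
    _ ≤ C * 2 ^ s := by rw [hNs]; exact hC hne

end Steps

/-! ### Repeated reduction of the exponent by a quarter. -/

/-- The encoding of a constant block. -/
def constLeaf : ℕ → ℕ → ℕ × List Bool := fun _ _ => (0, [])

/-- Exponents of the sides of nested blocks: `τ` times each exponent is reduced by a quarter, then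
the blocks are divided into cells. -/
def quarterLevels : ℕ → ℕ → List ℕ
  | 0, _ => [0]
  | τ + 1, s => (s - s / 4) :: quarterLevels τ (s - s / 4)

theorem length_quarterLevels (τ s : ℕ) : (quarterLevels τ s).length = τ + 1 := by
  induction τ generalizing s with
  | zero => rfl
  | succ τ ih => simp [quarterLevels, ih]

theorem levels_quarterLevels (τ s : ℕ) : Levels 0 s (quarterLevels τ s) := by
  induction τ generalizing s with
  | zero => exact ⟨Nat.zero_le _, rfl⟩
  | succ τ ih => exact ⟨Nat.sub_le _ _, ih _⟩

/-- Reducing by a quarter gives at most `2 ^ (s / 2)` children per block, which leaves room for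
`O(s)` bits per child within `O(2 ^ s)`. -/
theorem four_pow_quarter_mul_le (s : ℕ) : 4 ^ (s / 4) * (s + 1) ≤ 2 * 2 ^ s := by
  have h1 : (4 : ℕ) ^ (s / 4) = 2 ^ (2 * (s / 4)) := by rw [pow_mul]; norm_num
  have h2 : s + 1 ≤ 2 * (s - 2 * (s / 4) + 1) := by omega
  have h3 : s - 2 * (s / 4) + 1 ≤ 2 ^ (s - 2 * (s / 4)) := Nat.lt_two_pow_self
  calc 4 ^ (s / 4) * (s + 1) ≤ 2 ^ (2 * (s / 4)) * (2 * 2 ^ (s - 2 * (s / 4))) := by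
        rw [h1]; exact Nat.mul_le_mul_left _ (by omega)
    _ = 2 * (2 ^ (2 * (s / 4)) * 2 ^ (s - 2 * (s / 4))) := by ring
    _ = 2 * 2 ^ s := by rw [← pow_add]; congr 2; omega

/-- In a reduction step, the factor `1 / 2 ^ s` in the number of non-constant blocks cancels the
`O(2 ^ s)` bits per unit of difference. In the final division into cells it cancels only the field
width, and the number of cells per block remains. -/
theorem totalLength_quarterLevels_le {f : ℕ → ℕ → ℕ} (hf : Mono2 f) {M κ e : ℕ}
    (hM : ∀ i j, f i j ≤ M) (hκ : 8 * κ + 40 ≤ 2 ^ κ) (τ s : ℕ) (hs : s ≤ e) :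
    totalLength f constLeaf e (quarterLevels τ s) s ≤
      τ * (24 * (κ + 4) * 2 ^ e * M) +
        12 * (κ + 4) * 4 ^ ((fun s => s - s / 4)^[τ] s) * 2 ^ e * M := by
  have hlin : ∀ s, κ + 4 * s + 1 ≤ (κ + 4) * (s + 1) := fun s => by nlinarith [Nat.zero_le (κ * s)]
  have hleaf : ∀ X Y, (constLeaf X Y).2.length ≤ 2 ^ κ * 16 ^ 0 * blockDiff f 0 X Y := by
    simp [constLeaf]
  induction τ generalizing s with
  | zero =>
    have h := totalLength_cons_le_of_sparse (κ := κ) hf hM hκ hleaf (e := e) (s := s) (s' := 0)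
      (ss := []) (C := 12 * (κ + 4) * 4 ^ s * 2 ^ e * M) ⟨Nat.zero_le _, rfl⟩ hs ?_
    · have h0 : totalLength f constLeaf e [] 0 = 0 := by simp [totalLength, enc, constLeaf]
      rw [h0] at h
      simpa [quarterLevels] using h
    · intro _
      have h1 : s + 1 ≤ 2 ^ s := Nat.lt_two_pow_self
      calc 12 * 4 ^ (s - 0) * (κ + 4 * s + 1) * 2 ^ e * M
          ≤ 12 * 4 ^ s * ((κ + 4) * 2 ^ s) * 2 ^ e * M := by
            rw [Nat.sub_zero]
            gcongr
            exact (hlin s).trans (Nat.mul_le_mul_left _ h1)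
        _ = _ := by ring
  | succ τ ih =>
    have h := totalLength_cons_le_of_sparse (κ := κ) hf hM hκ hleaf (e := e) (s := s)
      (s' := s - s / 4) (ss := quarterLevels τ (s - s / 4)) (C := 24 * (κ + 4) * 2 ^ e * M)
      ⟨Nat.sub_le _ _, levels_quarterLevels _ _⟩ hs ?_
    · refine h.trans ((Nat.add_le_add_left (ih (s - s / 4) (by omega)) _).trans ?_)
      rw [Function.iterate_succ_apply]
      apply le_of_eq
      ring
    · intro _
      have h1 := four_pow_quarter_mul_le s
      rw [show s - (s - s / 4) = s / 4 by omega]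
      calc 12 * 4 ^ (s / 4) * (κ + 4 * s + 1) * 2 ^ e * M
          ≤ 12 * 4 ^ (s / 4) * ((κ + 4) * (s + 1)) * 2 ^ e * M := by gcongr; exact hlin s
        _ = 12 * (κ + 4) * 2 ^ e * M * (4 ^ (s / 4) * (s + 1)) := by ring
        _ ≤ 12 * (κ + 4) * 2 ^ e * M * (2 * 2 ^ s) := by gcongr
        _ = _ := by ring

theorem iterate_quarter_le (τ s : ℕ) :
    (((fun s => s - s / 4)^[τ] s : ℕ) : ℝ) ≤ (3 / 4) ^ τ * s + 3 := by
  induction τ with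
  | zero => simp
  | succ τ ih =>
    rw [Function.iterate_succ_apply']
    set x := (fun s : ℕ => s - s / 4)^[τ] s with hx
    -- Rounding loses at most `3 / 4` per step, and `3` is the fixed point of `x ↦ 3 * x / 4 + 3 /
    -- 4`.
    have h : 4 * (x - x / 4) ≤ 3 * x + 3 := by omega
    have h' : (4 : ℝ) * ((x - x / 4 : ℕ) : ℝ) ≤ 3 * x + 3 := by exact_mod_cast h
    rw [pow_succ]
    nlinarith

/-! ### A table of all small monotone blocks -/

/-- The monotone `B × B` arrays with values at most `d`. -/
def monoBlocks (B d : ℕ) : Finset (Fin B → Fin B → Fin (d + 1)) :=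
  Finset.univ.filter fun M => ∀ i i' j j', i ≤ i' → j ≤ j' → M i j ≤ M i' j'

/-- The number of entries of a row that are at most `t`. -/
def rowCount {B d : ℕ} (M : Fin B → Fin B → Fin (d + 1)) (t : ℕ) (i : Fin B) : ℕ :=
  (Finset.univ.filter fun j => (M i j : ℕ) ≤ t).card

theorem rowCount_le {B d : ℕ} (M : Fin B → Fin B → Fin (d + 1)) (t : ℕ) (i : Fin B) :
    rowCount M t i ≤ B := (Finset.card_le_univ _).trans (by simp)

/-- In a sorted row the entries at most `t` form an initial segment, so their number determines
them. -/
theorem le_iff_lt_rowCount {B d : ℕ} {M : Fin B → Fin B → Fin (d + 1)} (hM : M ∈ monoBlocks B d)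
    (t : ℕ) (i j : Fin B) : (M i j : ℕ) ≤ t ↔ (j : ℕ) < rowCount M t i := by
  have hM := (Finset.mem_filter.1 hM).2
  constructor
  · intro h
    have : Finset.Iic j ⊆ Finset.univ.filter fun j => (M i j : ℕ) ≤ t := by
      intro j' hj'
      have := hM i i j' j le_rfl (Finset.mem_Iic.1 hj')
      simp only [Finset.mem_filter, Finset.mem_univ, true_and]
      exact le_trans (by exact_mod_cast this) h
    have := Finset.card_le_card this
    rw [Fin.card_Iic] at this
    exact this
  · intro h
    by_contra hc
    have : (Finset.univ.filter fun j => (M i j : ℕ) ≤ t) ⊆ Finset.Iio j := by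
      intro j' hj'
      simp only [Finset.mem_filter, Finset.mem_univ, true_and] at hj'
      rw [Finset.mem_Iio]
      by_contra hjj
      have := hM i i j j' le_rfl (not_lt.1 hjj)
      exact hc (le_trans (by exact_mod_cast this) hj')
    have := Finset.card_le_card this
    rw [Fin.card_Iio] at this
    exact absurd h (not_lt.2 this)

/-- The boundary path of the cells with values at most `t`. -/
def levelPath {B d : ℕ} (M : Fin B → Fin B → Fin (d + 1)) (t : ℕ) (i : Fin B) : Fin (2 * B) :=
  ⟨i + (B - rowCount M t i), by have := i.2; omega⟩

/-- Row counts do not increase downwards since columns are sorted; the summand `i` makes the path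
strict, so it can be recovered from its range. -/
theorem strictMono_levelPath {B d : ℕ} {M : Fin B → Fin B → Fin (d + 1)}
    (hM : M ∈ monoBlocks B d) (t : ℕ) : StrictMono (levelPath M t) := by
  intro i i' h
  have hM := (Finset.mem_filter.1 hM).2
  have h1 : rowCount M t i' ≤ rowCount M t i := by
    refine Finset.card_le_card fun j hj => ?_
    simp only [Finset.mem_filter, Finset.mem_univ, true_and] at hj ⊢
    have := hM i i' j j h.le le_rfl
    exact le_trans (by exact_mod_cast this) hj
  have h2 : (i : ℕ) < i' := h
  simp only [levelPath, Fin.mk_lt_mk]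
  omega

/-- The paths for the thresholds `t < d` determine a block, the threshold `d` being trivial. Each
path is recorded as a subset of `Fin (2 * B)`, which gives `4 ^ B` choices. -/
theorem card_monoBlocks_le (B d : ℕ) : (monoBlocks B d).card ≤ 4 ^ (B * d) := by
  let F : (Fin B → Fin B → Fin (d + 1)) → (Fin d → Set (Fin (2 * B))) :=
    fun M t => Set.range (levelPath M t)
  have hinj : Set.InjOn F (monoBlocks B d) := by
    intro M hM M' hM' h
    have key : ∀ t : Fin d, ∀ i, rowCount M t i = rowCount M' t i := by
      intro t i
      have h1 := congrFun h t
      rw [StrictMono.range_inj (strictMono_levelPath hM t) (strictMono_levelPath hM' t)] at h1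
      have h2 := congrArg Fin.val (congrFun h1 i)
      simp only [levelPath] at h2
      have := rowCount_le M t i
      have := rowCount_le M' t i
      omega
    have h3 : ∀ i j, ∀ t < d, ((M i j : ℕ) ≤ t ↔ (M' i j : ℕ) ≤ t) := by
      intro i j t ht
      rw [le_iff_lt_rowCount hM, le_iff_lt_rowCount hM', key ⟨t, ht⟩ i]
    funext i j
    ext
    have h4 := (M i j).2
    have h5 := (M' i j).2
    rcases lt_trichotomy (M i j : ℕ) (M' i j : ℕ) with h6 | h6 | h6
    · have := h3 i j (M i j) (by omega); omega
    · exact h6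
    · have := h3 i j (M' i j) (by omega); omega
  have h := Finset.card_le_card_of_injOn (t := (Finset.univ : Finset (Fin d → Set (Fin (2 * B))))) F
    (fun _ _ => Finset.mem_univ _) hinj
  refine h.trans (le_of_eq ?_)
  rw [Finset.card_univ, Fintype.card_fun, Fintype.card_set, Fintype.card_fin, Fintype.card_fin,
    pow_mul, pow_mul]
  norm_num

/-- Strings in finite sets `S 0, S 1, …` can be stored so that those of `S d` have addresses bounded
by the total length of `S 0, …, S d`. -/
theorem exists_layout (S : ℕ → Finset (List Bool)) (N : ℕ) :
    ∃ T : List Bool, T.length = ∑ d ∈ Finset.range N, ∑ x ∈ S d, x.length ∧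
      ∀ d < N, ∀ x ∈ S d, ∃ p, p ≤ ∑ d' ∈ Finset.range (d + 1), ∑ x ∈ S d', x.length ∧
        p + x.length ≤ T.length ∧ Occ T p x := by
  induction N with
  | zero => exact ⟨[], by simp, by simp⟩
  | succ N ih =>
    obtain ⟨T, hT, h⟩ := ih
    have hlen : (S N).toList.flatten.length = ∑ x ∈ S N, x.length := by
      rw [List.length_flatten, Finset.sum_map_toList]
    refine ⟨T ++ (S N).toList.flatten, ?_, ?_⟩
    · rw [List.length_append, hT, Finset.sum_range_succ, hlen]
    · intro d hd x hx
      rcases Nat.lt_succ_iff_lt_or_eq.1 hd with hd | rfl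
      · obtain ⟨p, hp, hp', hO⟩ := h d hd x hx
        refine ⟨p, hp, by rw [List.length_append]; omega, ?_⟩
        have h0 : Occ (T ++ (S N).toList.flatten) 0 T := ⟨_, rfl⟩
        simpa using h0.trans hO (by omega)
      · obtain ⟨l₁, l₂, hl⟩ := List.append_of_mem (Finset.mem_toList.2 hx)
        have hfl : (S d).toList.flatten = l₁.flatten ++ x ++ l₂.flatten := by
          rw [hl]; simp
        have hle := congrArg List.length hfl
        rw [hlen, List.length_append, List.length_append] at hle
        refine ⟨T.length + l₁.flatten.length, ?_, ?_, ?_⟩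
        · rw [Finset.sum_range_succ, ← hT]; omega
        · rw [List.length_append, hlen]; omega
        · have := Occ.mk (T ++ l₁.flatten) x l₂.flatten
          rw [List.length_append] at this
          rw [hfl]
          simpa [List.append_assoc] using this

/-- A square array, extended to all indices. -/
def extendBlock {B d : ℕ} (hB : 0 < B) (M : Fin B → Fin B → Fin (d + 1)) (i j : ℕ) : ℕ :=
  M ⟨min i (B - 1), by omega⟩ ⟨min j (B - 1), by omega⟩

theorem mono2_extendBlock {B d : ℕ} (hB : 0 < B) {M : Fin B → Fin B → Fin (d + 1)}
    (hM : M ∈ monoBlocks B d) : Mono2 (extendBlock hB M) := by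
  intro i i' j j' hi hj
  have := (Finset.mem_filter.1 hM).2 ⟨min i (B - 1), by omega⟩ ⟨min i' (B - 1), by omega⟩
    ⟨min j (B - 1), by omega⟩ ⟨min j' (B - 1), by omega⟩
    (by simp only [Fin.mk_le_mk]; omega) (by simp only [Fin.mk_le_mk]; omega)
  exact_mod_cast this

theorem extendBlock_le {B d : ℕ} (hB : 0 < B) (M : Fin B → Fin B → Fin (d + 1)) (i j : ℕ) :
    extendBlock hB M i j ≤ d := Nat.lt_succ_iff.1 (Fin.is_lt _)

theorem length_constLeaf_le (f : ℕ → ℕ → ℕ) (κ lv X Y : ℕ) :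
    (constLeaf X Y).2.length ≤ 2 ^ κ * 16 ^ lv * blockDiff f lv X Y := by simp [constLeaf]

/-- Storing a block cell by cell. -/
theorem located_enc_cells {f : ℕ → ℕ → ℕ} (hf : Mono2 f) {κ K M s X Y p : ℕ} {D : List Bool}
    (hκ : 8 * κ + 40 ≤ 2 ^ κ) (hM : ∀ i j, f i j ≤ M) (hK : κ + 4 * s + M.size ≤ K)
    (hO : Occ D p (enc f constLeaf [0] s X Y).2) (hp : p ≤ D.length) {i j : ℕ} (hi : i < 2 ^ s)
    (hj : j < 2 ^ s) :
    Located D K 1 p (enc f constLeaf [0] s X Y).1 i j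
      (f (X * 2 ^ s + i) (Y * 2 ^ s + j) - f (X * 2 ^ s) (Y * 2 ^ s)) := by
  have := located_enc hf (leaf := constLeaf) (κ := κ) (lv := 0) (K := K) (h := 0) (M := M) (D := D)
    hκ hM (length_constLeaf_le f κ 0) (fun _ _ => by simp [constLeaf]) ?_ [0] s X Y p
    ⟨Nat.zero_le _, rfl⟩ hK hO hp i hi j hj
  · simpa using this
  · intro X Y p _ _ i hi j hj
    obtain rfl : i = 0 := by simpa using hi
    obtain rfl : j = 0 := by simpa using hj
    have := Located.done (D := D) (K := K) 0 p 0 0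
    simpa [constLeaf] using this

/-- One table serves all arrays: after subtraction of its first entry, a block of difference `d`
belongs to `monoBlocks (2 ^ v) d`. The address bound involves the block's own `d` and not `N`; this
keeps references to nearly constant blocks short. -/
theorem exists_table (v N : ℕ) :
    ∃ T : List Bool, T.length ≤ N * (4 ^ (2 ^ v * N) * (2 ^ 8 * 16 ^ v * N)) ∧
      ∀ f : ℕ → ℕ → ℕ, Mono2 f → ∀ X Y, blockDiff f v X Y < N → ∃ p W,
        p ≤ (blockDiff f v X Y + 1) *
          (4 ^ (2 ^ v * blockDiff f v X Y) * (2 ^ 8 * 16 ^ v * blockDiff f v X Y)) ∧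
        W ≤ 2 ^ 8 * 16 ^ v * blockDiff f v X Y ∧ p ≤ T.length ∧
        ∀ (D : List Bool) (K a : ℕ), Occ D a T → a + T.length ≤ D.length →
          8 + 4 * v + (blockDiff f v X Y).size ≤ K → ∀ i < 2 ^ v, ∀ j < 2 ^ v,
            Located D K 1 (a + p) W i j
              (f (X * 2 ^ v + i) (Y * 2 ^ v + j) - f (X * 2 ^ v) (Y * 2 ^ v)) := by
  classical
  have hB : 0 < 2 ^ v := by positivity
  have hκ : 8 * 8 + 40 ≤ 2 ^ 8 := by norm_num
  set S : ℕ → Finset (List Bool) := fun d =>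
    (monoBlocks (2 ^ v) d).image fun M => (enc (extendBlock hB M) constLeaf [0] v 0 0).2 with hS
  have hlenM : ∀ d, ∀ M ∈ monoBlocks (2 ^ v) d,
      (enc (extendBlock hB M) constLeaf [0] v 0 0).2.length ≤ 2 ^ 8 * 16 ^ v * d := by
    intro d M hM
    refine ((length_enc_le (mono2_extendBlock hB hM) (κ := 8) (lv := 0) hκ
      (length_constLeaf_le _ 8 0) [0] v 0 0 ⟨Nat.zero_le _, rfl⟩).1).trans ?_
    exact Nat.mul_le_mul_left _ ((Nat.sub_le _ _).trans (extendBlock_le hB M _ _))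
  have hsum : ∀ d, ∑ x ∈ S d, x.length ≤ 4 ^ (2 ^ v * d) * (2 ^ 8 * 16 ^ v * d) := by
    intro d
    refine (Finset.sum_le_card_nsmul _ _ (2 ^ 8 * 16 ^ v * d) fun x hx => ?_).trans ?_
    · obtain ⟨M, hM, rfl⟩ := Finset.mem_image.1 hx
      exact hlenM d M hM
    · rw [smul_eq_mul]
      exact Nat.mul_le_mul_right _ (Finset.card_image_le.trans (card_monoBlocks_le _ _))
  have hmono : ∀ d N, d ≤ N → 4 ^ (2 ^ v * d) * (2 ^ 8 * 16 ^ v * d) ≤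
      4 ^ (2 ^ v * N) * (2 ^ 8 * 16 ^ v * N) := by
    intro d N h
    exact Nat.mul_le_mul (Nat.pow_le_pow_right (by norm_num) (Nat.mul_le_mul_left _ h))
      (Nat.mul_le_mul_left _ h)
  have htot : ∀ k N, (∀ d < k, d ≤ N) → ∑ d ∈ Finset.range k, ∑ x ∈ S d, x.length ≤
      k * (4 ^ (2 ^ v * N) * (2 ^ 8 * 16 ^ v * N)) := by
    intro k N h
    refine (Finset.sum_le_card_nsmul _ _ _ fun d hd =>
      (hsum d).trans (hmono d N (h d (Finset.mem_range.1 hd)))).trans (by simp)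
  obtain ⟨T, hT, hlay⟩ := exists_layout S N
  refine ⟨T, ?_, ?_⟩
  · rw [hT]; exact htot N N fun d hd => hd.le
  intro f hf X Y hd
  set d := blockDiff f v X Y with hdd
  set M : Fin (2 ^ v) → Fin (2 ^ v) → Fin (d + 1) := fun i j =>
    ⟨f (X * 2 ^ v + i) (Y * 2 ^ v + j) - f (X * 2 ^ v) (Y * 2 ^ v),
      Nat.lt_succ_iff.2 (mono2_sub_le_blockDiff hf i.2 j.2)⟩ with hMdef
  have hM : M ∈ monoBlocks (2 ^ v) d := by
    refine Finset.mem_filter.2 ⟨Finset.mem_univ _, fun i i' j j' hi hj => ?_⟩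
    simp only [hMdef, Fin.mk_le_mk]
    exact Nat.sub_le_sub_right (hf (Nat.add_le_add_left hi _) (Nat.add_le_add_left hj _)) _
  obtain ⟨p, hp, hp', hO⟩ := hlay d hd _ (Finset.mem_image_of_mem _ hM)
  refine ⟨p, (enc (extendBlock hB M) constLeaf [0] v 0 0).1, ?_, ?_, by omega, ?_⟩
  · exact hp.trans (htot (d + 1) d fun d' hd' => Nat.lt_succ_iff.1 hd')
  · exact (fst_enc_le (fun _ _ => by simp [constLeaf]) _ _ _ _).trans (hlenM d M hM)
  intro D K a hOT hle hK i hi j hj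
  have := located_enc_cells (mono2_extendBlock hB hM) hκ (extendBlock_le hB M) hK
    (hOT.trans hO (by omega)) (by omega) hi hj
  have h1 : min i (2 ^ v - 1) = i := by omega
  have h2 : min j (2 ^ v - 1) = j := by omega
  simpa [extendBlock, hMdef, h1, h2] using this

/-! ### Blocks that refer to the table -/

/-- With `B = 2 ^ v` there are `B ^ 2` cells with fields of `O(v + d / B ^ 2)` bits. Since `v < B`
and `B ^ 2 ≤ d`, the total `O(B ^ 3 + d)` is `O(B * d)`. -/
theorem length_enc_cells_le {f : ℕ → ℕ → ℕ} (hf : Mono2 f) {v X Y : ℕ}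
    (hd : 4 ^ v ≤ blockDiff f v X Y) :
    (enc f constLeaf [0] v X Y).2.length ≤ 90 * (2 ^ v * blockDiff f v X Y) := by
  rcases Nat.eq_zero_or_pos v with rfl | hv
  · simp [enc, constLeaf]
  have h := length_enc_cons_le (κ := 8) (ss := []) hf (by norm_num) (length_constLeaf_le f 8 0)
    (s := v) (s' := 0) ⟨Nat.zero_le _, rfl⟩ hv.ne' X Y
  have hz : ∀ X Y, (enc f constLeaf [] 0 X Y).2.length = 0 := by simp [enc, constLeaf]
  simp only [hz, Finset.sum_const_zero, add_zero] at h
  have hd0 : blockDiff f v X Y ≠ 0 := by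
    have : 0 < 4 ^ v := by positivity
    omega
  rw [if_neg hd0, Nat.sub_zero] at h
  refine le_trans h ?_
  set d := blockDiff f v X Y with hdd
  set B := 2 ^ v with hB
  have h4 : (4 : ℕ) ^ v = B * B := by rw [hB, ← mul_pow]; norm_num
  have h1 := size_le_add_div (2 * v) d
  have h2 : 4 ^ v * (d / 2 ^ (2 * v)) ≤ d := by
    rw [pow_mul]; exact Nat.mul_div_le d _
  have hvB : v + 1 ≤ B := Nat.lt_two_pow_self
  rw [h4] at hd h2 ⊢
  have h3 : B * B * (8 + 4 * v + d.size) ≤ B * B * (14 * B) + d := by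
    calc B * B * (8 + 4 * v + d.size) ≤ B * B * (8 + 6 * v + d / 2 ^ (2 * v)) := by
          exact Nat.mul_le_mul_left _ (by omega)
      _ = B * B * (8 + 6 * v) + B * B * (d / 2 ^ (2 * v)) := by ring
      _ ≤ _ := by gcongr; omega
  have h5 : B * (B * B) ≤ B * d := Nat.mul_le_mul_left _ hd
  have h6 : d ≤ B * d := Nat.le_mul_of_pos_left _ (by omega)
  nlinarith

/-- Blocks of side `2 ^ v` can be encoded in space proportional to side times difference, by
references to a table, or cell by cell if the difference is large. -/
theorem exists_tableLeaf {f : ℕ → ℕ → ℕ} (hf : Mono2 f) {M v κ a : ℕ} (hM : ∀ i j, f i j ≤ M)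
    (ha : a ≤ 2 ^ (κ + 2 ^ v)) :
    ∃ (T : List Bool) (leaf : ℕ → ℕ → ℕ × List Bool),
      T.length ≤ 2 ^ (10 * 8 ^ v + 8) ∧
      (∀ X Y, (leaf X Y).2.length ≤ (3 * κ + 144) * (2 ^ v * blockDiff f v X Y)) ∧
      (∀ X Y, (leaf X Y).1 ≤ (leaf X Y).2.length) ∧
      ∀ (D : List Bool) (K : ℕ), Occ D a T → a + T.length ≤ D.length →
        8 + 4 * v + M.size ≤ K → κ + 10 + 8 * 8 ^ v ≤ K → ∀ X Y p, Occ D p (leaf X Y).2 →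
          p ≤ D.length → ∀ i < 2 ^ v, ∀ j < 2 ^ v, Located D K 2 p (leaf X Y).1 i j
            (f (X * 2 ^ v + i) (Y * 2 ^ v + j) - f (X * 2 ^ v) (Y * 2 ^ v)) := by
  obtain ⟨T, hT, htab⟩ := exists_table v (4 ^ v)
  have h8 : (8 : ℕ) ^ v = 2 ^ v * 4 ^ v := by rw [← mul_pow]; norm_num
  have htab' : ∀ X Y, ∃ p W, blockDiff f v X Y < 4 ^ v → (
      p ≤ (blockDiff f v X Y + 1) *
        (4 ^ (2 ^ v * blockDiff f v X Y) * (2 ^ 8 * 16 ^ v * blockDiff f v X Y)) ∧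
      W ≤ 2 ^ 8 * 16 ^ v * blockDiff f v X Y ∧ p ≤ T.length ∧
      ∀ (D : List Bool) (K a : ℕ), Occ D a T → a + T.length ≤ D.length →
        8 + 4 * v + (blockDiff f v X Y).size ≤ K → ∀ i < 2 ^ v, ∀ j < 2 ^ v,
          Located D K 1 (a + p) W i j
            (f (X * 2 ^ v + i) (Y * 2 ^ v + j) - f (X * 2 ^ v) (Y * 2 ^ v))) := by
    intro X Y
    by_cases h : blockDiff f v X Y < 4 ^ v
    · obtain ⟨p, W, h1⟩ := htab f hf X Y h
      exact ⟨p, W, fun _ => h1⟩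
    · exact ⟨0, 0, fun h' => absurd h' h⟩
  choose p W hpW using htab'
  set J : ℕ → ℕ → ℕ := fun X Y => Nat.size (a + p X Y + W X Y + 1) with hJ
  have hJle : ∀ X Y, blockDiff f v X Y ≠ 0 → blockDiff f v X Y < 4 ^ v →
      J X Y ≤ κ + 10 + 8 * (2 ^ v * blockDiff f v X Y) := by
    intro X Y h0 hlt
    obtain ⟨hp, hW, -, -⟩ := hpW X Y hlt
    set d := blockDiff f v X Y with hd
    set B := 2 ^ v with hB
    have hd1 : 1 ≤ d := Nat.one_le_iff_ne_zero.2 h0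
    have hB1 : v + 1 ≤ B := Nat.lt_two_pow_self
    have hBd : B ≤ B * d := Nat.le_mul_of_pos_right _ hd1
    have hdB : d ≤ B * d := Nat.le_mul_of_pos_left _ (by omega)
    have h16 : (16 : ℕ) ^ v = 2 ^ (4 * v) := by rw [pow_mul]; norm_num
    have h4 : (4 : ℕ) ^ (B * d) = 2 ^ (2 * (B * d)) := by rw [pow_mul 2 2]; norm_num
    have hdp : d + 1 ≤ 2 ^ d := Nat.lt_two_pow_self
    have e1 : p X Y ≤ 2 ^ (κ + 8 + 8 * (B * d)) := by
      calc p X Y ≤ 2 ^ d * (2 ^ (2 * (B * d)) * (2 ^ 8 * 2 ^ (4 * v) * 2 ^ d)) := by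
            refine hp.trans ?_
            rw [h16, h4]
            gcongr
            omega
        _ = 2 ^ (d + (2 * (B * d) + (8 + 4 * v + d))) := by
            rw [pow_add, pow_add, pow_add, pow_add]
        _ ≤ _ := Nat.pow_le_pow_right (by norm_num) (by omega)
    have e2 : W X Y ≤ 2 ^ (κ + 8 + 8 * (B * d)) := by
      calc W X Y ≤ 2 ^ 8 * 2 ^ (4 * v) * 2 ^ d := by
            refine hW.trans ?_
            rw [h16]
            gcongr
            omega
        _ = 2 ^ (8 + 4 * v + d) := by rw [pow_add, pow_add]
        _ ≤ _ := Nat.pow_le_pow_right (by norm_num) (by omega)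
    -- The absolute start of the table accounts for `κ + 2 ^ v` bits of an address, which is
    -- affordable because a non-constant block has `d ≥ 1`.
    have e3 : a ≤ 2 ^ (κ + 8 + 8 * (B * d)) :=
      ha.trans (Nat.pow_le_pow_right (by norm_num) (by omega))
    have e4 : 1 < 2 ^ (κ + 8 + 8 * (B * d)) := Nat.one_lt_two_pow (by omega)
    simp only [hJ]
    rw [Nat.size_le, show κ + 10 + 8 * (B * d) = (κ + 8 + 8 * (B * d)) + 2 by ring, pow_add]
    omega
  -- Large differences have no table entry and are stored cell by cell. A reference is a jump node,
  -- marked by a zero first field, followed by an absolute address and a field width.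
  refine ⟨T, fun X Y => if blockDiff f v X Y = 0 then (0, []) else
    if 4 ^ v ≤ blockDiff f v X Y then enc f constLeaf [0] v X Y else
      (J X Y, natBits (J X Y) 0 ++ (natBits (J X Y) (a + p X Y) ++ natBits (J X Y) (W X Y))),
    ?_, ?_, ?_, ?_⟩
  · refine hT.trans ?_
    have h4 : (4 : ℕ) ^ v = 2 ^ (2 * v) := by rw [pow_mul]; norm_num
    have h16 : (16 : ℕ) ^ v = 2 ^ (4 * v) := by rw [pow_mul]; norm_num
    have h48 : (4 : ℕ) ^ (2 ^ v * 4 ^ v) = 2 ^ (2 * 8 ^ v) := by rw [h8, pow_mul 2 2]; norm_num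
    have hv : v ≤ 8 ^ v := (Nat.lt_pow_self (by norm_num)).le
    calc 4 ^ v * (4 ^ (2 ^ v * 4 ^ v) * (2 ^ 8 * 16 ^ v * 4 ^ v))
        = 2 ^ (2 * v) * (2 ^ (2 * 8 ^ v) * (2 ^ 8 * 2 ^ (4 * v) * 2 ^ (2 * v))) := by
          rw [h48, h16, h4]
      _ = 2 ^ (2 * v + (2 * 8 ^ v + (8 + 4 * v + 2 * v))) := by
          rw [pow_add, pow_add, pow_add, pow_add]
      _ ≤ _ := Nat.pow_le_pow_right (by norm_num) (by omega)
  · intro X Y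
    dsimp only
    split_ifs with h0 hd
    · simp
    · refine (length_enc_cells_le hf hd).trans (Nat.mul_le_mul_right _ (by omega))
    · have := hJle X Y h0 (not_le.1 hd)
      simp only [List.length_append, length_natBits]
      set x := 2 ^ v * blockDiff f v X Y with hx
      have hx1 : 1 ≤ x := Nat.mul_pos (by positivity) (Nat.pos_of_ne_zero h0)
      have : κ ≤ κ * x := Nat.le_mul_of_pos_right _ hx1
      nlinarith
  · intro X Y
    dsimp only
    split_ifs with h0 hd
    · simp
    · exact fst_enc_le (fun _ _ => by simp [constLeaf]) _ _ _ _
    · simp only [List.length_append, length_natBits]; omega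
  · intro D K hOT hlen hK hK' X Y q hO hq i hi j hj
    have hdM : blockDiff f v X Y ≤ M := (Nat.sub_le _ _).trans (hM _ _)
    dsimp only at hO ⊢
    split_ifs at hO ⊢ with h0 hd
    · have := mono2_sub_le_blockDiff hf (X := X) (Y := Y) hi hj
      rw [h0, Nat.le_zero] at this
      rw [this]
      exact .done ..
    · exact (located_enc_cells hf (κ := 8) (by norm_num) hM hK hO hq hi hj).mono (by norm_num)
    · have hJ1 := hJle X Y h0 (not_le.1 hd)
      obtain ⟨-, -, hpT, hloc⟩ := hpW X Y (not_le.1 hd)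
      have hsz : a + p X Y + W X Y + 1 < 2 ^ J X Y := Nat.lt_size_self _
      have hJK : J X Y ≤ K := by
        have : 2 ^ v * blockDiff f v X Y ≤ 8 ^ v := by
          rw [h8]; exact Nat.mul_le_mul_left _ (not_le.1 hd).le
        omega
      have hJ0 : 0 < J X Y := by
        by_contra hc
        rw [Nat.eq_zero_of_not_pos hc, pow_zero] at hsz
        omega
      dsimp only at hO ⊢
      generalize J X Y = w at hO hsz hJK hJ0 ⊢
      have hle := hO.length_le hq
      obtain ⟨o1, hO⟩ := occ_append hO
      obtain ⟨o2, o3⟩ := occ_append hO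
      simp only [List.length_append, length_natBits] at hle o2 o3
      refine .jump 1 q w i j (a + p X Y) (W X Y) _ hJ0 hJK (o1.bitField (by omega))
        (o2.bitField (by omega)) ?_ (by omega) (by omega) (hloc D K a hOT hlen ?_ i hi j hj)
      · rw [← add_assoc]; exact o3.bitField (by omega)
      · have := Nat.size_le_size hdM
        omega

/-! ### The data structure -/

/-- The array `A`, extended to all indices. -/
def extendArray {n : ℕ} (hn : 0 < n) (A : Fin n → Fin n → ℕ) (i j : ℕ) : ℕ :=
  A ⟨min i (n - 1), by omega⟩ ⟨min j (n - 1), by omega⟩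

theorem mono2_extendArray {n m : ℕ} (hn : 0 < n) {A : Fin n → Fin n → ℕ} (hA : A ∈ IMS2 n m) :
    Mono2 (extendArray hn A) := by
  intro i i' j j' hi hj
  have h1 : (⟨min i (n - 1), by omega⟩ : Fin n) ≤ ⟨min i' (n - 1), by omega⟩ := by
    simp only [Fin.mk_le_mk]; omega
  have h2 : (⟨min j (n - 1), by omega⟩ : Fin n) ≤ ⟨min j' (n - 1), by omega⟩ := by
    simp only [Fin.mk_le_mk]; omega
  exact (hA.1 _ h2).trans (hA.2.1 _ h1)

theorem extendArray_le {n m : ℕ} (hn : 0 < n) {A : Fin n → Fin n → ℕ} (hA : A ∈ IMS2 n m)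
    (i j : ℕ) : extendArray hn A i j ≤ m := (hA.2.2 _ _).le

theorem size_le_of_le_two_pow {x e : ℕ} (h : x ≤ 2 ^ e) : x.size ≤ e + 1 :=
  Nat.size_le.2 (h.trans_lt (Nat.pow_lt_pow_right (by norm_num) (by omega)))

/-- A header, a table and the tree of blocks together answer all queries. -/
theorem exists_answers {n m e κ H w h lv : ℕ} (hn : 0 < n) (hne : n < 2 ^ e) (hmn : m ≤ n)
    {A : Fin n → Fin n → ℕ} (hA : A ∈ IMS2 n m) (hκ : 8 * κ + 40 ≤ 2 ^ κ)
    (hH : κ + 5 * e + 1 ≤ H) (hHw : 4 * H + 1 < w)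
    {T : List Bool} {leaf : ℕ → ℕ → ℕ × List Bool} {ss : List ℕ} (hss : Levels lv e ss)
    (hleaf : ∀ X Y, (leaf X Y).2.length ≤
      2 ^ κ * 16 ^ lv * blockDiff (extendArray hn A) lv X Y)
    (hfst : ∀ X Y, (leaf X Y).1 ≤ (leaf X Y).2.length)
    (hloc : ∀ D, Occ D (4 * H + 1) T → 4 * H + 1 + T.length ≤ D.length → ∀ X Y p,
      Occ D p (leaf X Y).2 → p ≤ D.length → ∀ i < 2 ^ lv, ∀ j < 2 ^ lv,
        Located D H h p (leaf X Y).1 i j (extendArray hn A (X * 2 ^ lv + i) (Y * 2 ^ lv + j) -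
          extendArray hn A (X * 2 ^ lv) (Y * 2 ^ lv)))
    (hT : 4 * H + 1 + T.length < 2 ^ H)
    (hlen : 4 * H + 1 + T.length + 2 ^ (κ + 5 * e) + 1 < 2 ^ w) :
    ∃ D : List Bool,
      D.length = 4 * H + 1 + T.length + totalLength (extendArray hn A) leaf e ss e ∧
      ∀ i j : Fin n, WordRAM.Answers w D WordRAM.queryProgram i j (A i j)
        (WordRAM.queryCost * (h + ss.length + 2)) := by
  set f := extendArray hn A with hf
  have hmono : Mono2 f := mono2_extendArray hn hA
  have hM : ∀ i j, f i j ≤ m := extendArray_le hn hA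
  set E := enc f leaf ss e 0 0 with hE
  have hElen : E.2.length ≤ 2 ^ (κ + 5 * e) := by
    refine ((length_enc_le hmono hκ hleaf ss e 0 0 hss).1).trans ?_
    have h1 : blockDiff f e 0 0 ≤ 2 ^ e := ((Nat.sub_le _ _).trans (hM _ _)).trans (by omega)
    have h16 : (16 : ℕ) ^ e = 2 ^ (4 * e) := by rw [pow_mul]; norm_num
    calc 2 ^ κ * 16 ^ e * blockDiff f e 0 0 ≤ 2 ^ κ * 2 ^ (4 * e) * 2 ^ e := by
          rw [h16]; exact Nat.mul_le_mul_left _ h1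
      _ = 2 ^ (κ + 5 * e) := by rw [← pow_add, ← pow_add]; congr 1; ring
  have hEH : 2 ^ (κ + 5 * e) < 2 ^ H := Nat.pow_lt_pow_right (by norm_num) (by omega)
  have hE1 : E.1 ≤ E.2.length := fst_enc_le hfst _ _ _ _
  -- The header has exactly `4 * H + 1` bits, so the table starts at an address that is independent
  -- of its content.
  set D := natBits (H + 1) (2 ^ H) ++ (natBits H E.1 ++ (natBits H (f 0 0) ++
    (natBits H (4 * H + 1 + T.length) ++ (T ++ E.2)))) with hD
  have hDlen : D.length = 4 * H + 1 + T.length + E.2.length := by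
    simp only [hD, List.length_append, length_natBits]; ring
  refine ⟨D, ?_, ?_⟩
  · rw [hDlen]; simp [totalLength, hE]
  have hO : Occ D 0 D := by simp [Occ]
  obtain ⟨o1, hO⟩ := occ_append hO
  obtain ⟨o2, hO⟩ := occ_append hO
  obtain ⟨o3, hO⟩ := occ_append hO
  obtain ⟨o4, hO⟩ := occ_append hO
  obtain ⟨o5, o6⟩ := occ_append hO
  simp only [length_natBits, zero_add] at o2 o3 o4 o5 o6
  rw [show H + 1 + H = 2 * H + 1 by ring] at o3 o4 o5 o6
  rw [show 2 * H + 1 + H = 3 * H + 1 by ring] at o4 o5 o6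
  rw [show 3 * H + 1 + H = 4 * H + 1 by ring] at o5 o6
  have hnH : n < 2 ^ H := hne.trans_le (Nat.pow_le_pow_right (by norm_num) (by omega))
  have hew : 2 ^ e ≤ 2 ^ w := Nat.pow_le_pow_right (by norm_num) (by omega)
  have f1 := o1.bitField (Nat.pow_lt_pow_right (by norm_num) (by omega))
  have f2 := o2.bitField (v := E.1) (by omega)
  have f3 := o3.bitField (v := f 0 0) (by have := hM 0 0; omega)
  have f4 := o4.bitField hT
  intro i j
  have hi := i.2
  have hj := j.2
  have hfij : f i j = A i j := by
    simp only [hf, extendArray]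
    congr 1 <;>
    · ext; simp only []; omega
  have hloc' := located_enc hmono (K := H) (h := h) (D := D) hκ hM hleaf hfst
    (hloc D o5 (by omega)) ss e 0 0 (4 * H + 1 + T.length) hss
    (by have := size_le_of_le_two_pow (hmn.trans hne.le); omega) o6 (by omega) i (by omega)
    j (by omega)
  simp only [zero_mul, zero_add] at hloc'
  have h00 : f 0 0 ≤ f i j := hmono (Nat.zero_le _) (Nat.zero_le _)
  have hAm := hM i j
  have key := WordRAM.answers_queryProgram (w := w) (K := H) (H := H) (i := i) (j := j) (by omega)
    (by omega) hHw f1 (by omega) (by omega) f3 (by rw [f2, f4]; exact hloc') (by omega)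
  rwa [Nat.add_sub_cancel' h00, hfij] at key

/-! ### Choice of the parameters -/

/-- `8 ^ v` is `O(u ^ 3)`, hence polylogarithmic in `e`; this makes the table length `O(2 ^ e)`. The
constant `γ` absorbs the cases `u < 30`. -/
theorem exists_exponent_bound : ∃ γ : ℕ, ∀ e u v : ℕ, 0 < e → u = e.size → v = u.size →
    10 * 8 ^ v + 8 ≤ γ + e := by
  have key : ∀ u : ℕ, 30 ≤ u → 80 * u ^ 3 + 8 ≤ 2 ^ (u - 1) := by
    intro u hu
    induction u, hu using Nat.le_induction with
    | base => norm_num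
    | succ u hu ih =>
      have h1 : 2 ^ (u + 1 - 1) = 2 * 2 ^ (u - 1) := by
        rw [← pow_succ']; congr 1; omega
      have h2 : (u + 1) ^ 3 ≤ 2 * u ^ 3 := by nlinarith [Nat.mul_le_mul hu hu]
      omega
  refine ⟨80 * 30 ^ 3 + 8, fun e u v he hu hv => ?_⟩
  have hu0 : 0 < u := by rw [hu]; exact Nat.size_pos.2 he
  have hv0 : 0 < v := by rw [hv]; exact Nat.size_pos.2 hu0
  have h1 : 2 ^ (u - 1) ≤ e := Nat.lt_size.1 (by omega)
  have h2 : 2 ^ (v - 1) ≤ u := Nat.lt_size.1 (by omega)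
  have h3 : 8 ^ v ≤ 8 * u ^ 3 := by
    obtain ⟨x, rfl⟩ : ∃ x, v = x + 1 := ⟨v - 1, by omega⟩
    calc 8 ^ (x + 1) = 8 * (2 ^ x) ^ 3 := by
          rw [pow_succ, ← pow_mul, mul_comm x 3, pow_mul]; norm_num; ring
      _ ≤ 8 * u ^ 3 := by gcongr; simpa using h2
  rcases le_or_gt 30 u with h | h
  · have := key u h; omega
  · have : u ^ 3 ≤ 30 ^ 3 := Nat.pow_le_pow_left h.le 3
    omega

/-- The cost of the first two levels. -/
theorem totalLength_top_le {f : ℕ → ℕ → ℕ} (hf : Mono2 f) {leaf : ℕ → ℕ → ℕ × List Bool}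
    {κ lv n m e r u v : ℕ} {ss : List ℕ} (hM : ∀ i j, f i j ≤ m) (hκ : 8 * κ + 40 ≤ 2 ^ κ)
    (hleaf : ∀ X Y, (leaf X Y).2.length ≤ 2 ^ κ * 16 ^ lv * blockDiff f lv X Y)
    (hen : 2 ^ e ≤ 2 * n) (hr : n ≤ 2 * m * 2 ^ r) (hu : e < 2 ^ u) (hv : u < 2 ^ v)
    (hl : Levels lv e (min e (r + 2 * u) :: max r v :: ss)) :
    totalLength f leaf e (min e (r + 2 * u) :: max r v :: ss) e ≤
      (96 * κ + 1008) * (n * m) + totalLength f leaf e ss (max r v) := by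
  have h4e : 4 ^ e ≤ 8 * (n * m) * 2 ^ r := by
    calc 4 ^ e = 2 ^ e * 2 ^ e := by rw [← mul_pow]; norm_num
      _ ≤ (2 * n) * (2 * (2 * m * 2 ^ r)) := Nat.mul_le_mul hen (hen.trans (by omega))
      _ = _ := by ring
  have hnm : 2 * 2 ^ e * m ≤ 4 * (n * m) := by
    calc 2 * 2 ^ e * m ≤ 2 * (2 * n) * m := by gcongr
      _ = _ := by ring
  -- Common form of both steps: as `4 ^ e = O(n * m * 2 ^ r)`, a level costs `O(a * n * m)` once its
  -- field width times `2 ^ r` is at most `a * 4 ^ s'`.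
  have hgen : ∀ s s' a, (κ + 5 * s) * 2 ^ r ≤ a * 4 ^ s' →
      6 * (4 ^ e * (κ + 5 * s) + 2 * 2 ^ e * m) ≤ (48 * a + 24) * (n * m) * 4 ^ s' := by
    intro s s' a h
    have h1 : 1 ≤ 4 ^ s' := Nat.one_le_pow _ _ (by norm_num)
    calc 6 * (4 ^ e * (κ + 5 * s) + 2 * 2 ^ e * m)
        ≤ 6 * (8 * (n * m) * 2 ^ r * (κ + 5 * s) + 4 * (n * m) * 4 ^ s') := by
          refine Nat.mul_le_mul_left _ (Nat.add_le_add (Nat.mul_le_mul_right _ h4e) ?_)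
          exact hnm.trans (Nat.le_mul_of_pos_right _ h1)
      _ = 48 * (n * m) * ((κ + 5 * s) * 2 ^ r) + 24 * (n * m) * 4 ^ s' := by ring
      _ ≤ 48 * (n * m) * (a * 4 ^ s') + 24 * (n * m) * 4 ^ s' := by gcongr
      _ = _ := by ring
  have hlin : ∀ x y : ℕ, 1 ≤ y → x ≤ y → ∀ c, κ + c * x ≤ (κ + c) * y := by
    intro x y hy hx c
    rw [add_mul]
    exact Nat.add_le_add (Nat.le_mul_of_pos_right _ hy) (Nat.mul_le_mul_left _ hx)
  have hstep0 := totalLength_cons_le_of_dense (C := (48 * (κ + 5) + 24) * (n * m)) hf hM hκ hleaf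
    hl le_rfl (fun hne => hgen _ _ _ ?_)
  · have hstep1 := totalLength_cons_le_of_dense (C := (48 * (κ + 15) + 24) * (n * m)) hf hM hκ
      hleaf hl.2 hl.1 (fun _ => hgen _ _ _ ?_)
    · refine hstep0.trans ((Nat.add_le_add_left hstep1 _).trans (le_of_eq ?_))
      ring
    -- One factor `2 ^ max r v` of `4 ^ max r v` pays for `2 ^ r`, the other for the field width
    -- `O(r + u)`, because `r < 2 ^ r` and `u < 2 ^ v`.
    · have h1 : 2 ^ r ≤ 2 ^ max r v := Nat.pow_le_pow_right (by norm_num) (le_max_left _ _)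
      have h2 : 2 ^ v ≤ 2 ^ max r v := Nat.pow_le_pow_right (by norm_num) (le_max_right _ _)
      have h3 : r < 2 ^ r := Nat.lt_two_pow_self
      have h4 : min e (r + 2 * u) ≤ r + 2 * u := min_le_right _ _
      have h5 : κ + 15 * max r u ≤ (κ + 15) * 2 ^ max r v :=
        hlin _ _ (Nat.one_le_pow _ _ (by norm_num)) (max_le (by omega) (by omega)) 15
      have h6 : r ≤ max r u := le_max_left _ _
      have h7 : u ≤ max r u := le_max_right _ _
      calc (κ + 5 * min e (r + 2 * u)) * 2 ^ r ≤ ((κ + 15) * 2 ^ max r v) * 2 ^ max r v :=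
            Nat.mul_le_mul (by omega) h1
        _ = (κ + 15) * 4 ^ max r v := by rw [mul_assoc, ← mul_pow]; norm_num
  · have hs1 : min e (r + 2 * u) = r + 2 * u := by omega
    rw [hs1]
    have h1 : κ + 5 * e ≤ (κ + 5) * 2 ^ u := hlin _ _ (Nat.one_le_pow _ _ (by norm_num)) hu.le 5
    have h2 : (2 : ℕ) ^ u * 2 ^ r ≤ 4 ^ (r + 2 * u) := by
      rw [← pow_add, show (4 : ℕ) = 2 ^ 2 by norm_num, ← pow_mul]
      exact Nat.pow_le_pow_right (by norm_num) (by omega)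
    calc (κ + 5 * e) * 2 ^ r ≤ (κ + 5) * 2 ^ u * 2 ^ r := Nat.mul_le_mul_right _ h1
      _ = (κ + 5) * (2 ^ u * 2 ^ r) := by ring
      _ ≤ _ := Nat.mul_le_mul_left _ h2

theorem totalLength_nil_le {f : ℕ → ℕ → ℕ} (hf : Mono2 f) {leaf : ℕ → ℕ → ℕ × List Bool}
    {M e v C : ℕ} (hM : ∀ i j, f i j ≤ M) (hv : v ≤ e)
    (hleaf : ∀ X Y, (leaf X Y).2.length ≤ C * (2 ^ v * blockDiff f v X Y)) :
    totalLength f leaf e [] v ≤ 2 * C * 2 ^ e * M := by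
  have hve : 2 ^ (e - v) * 2 ^ v = 2 ^ e := by rw [← pow_add]; congr 1; omega
  calc totalLength f leaf e [] v ≤ ∑ X ∈ Finset.range (2 ^ (e - v)),
        ∑ Y ∈ Finset.range (2 ^ (e - v)), C * 2 ^ v * blockDiff f v X Y :=
        Finset.sum_le_sum fun X _ => Finset.sum_le_sum fun Y _ => by
          rw [mul_assoc]; exact hleaf X Y
    _ = C * 2 ^ v * ∑ X ∈ Finset.range (2 ^ (e - v)),
        ∑ Y ∈ Finset.range (2 ^ (e - v)), blockDiff f v X Y := by simp only [Finset.mul_sum]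
    _ ≤ C * 2 ^ v * (2 * 2 ^ (e - v) * M) := by gcongr; exact sum_blockDiff_le hf hM v _
    _ = 2 * C * (2 ^ (e - v) * 2 ^ v) * M := by ring
    _ = _ := by rw [hve]

/-- After `3 (t + 1)` reductions by a quarter, the exponent has shrunk below `r / 2 ^ (t + 1)`, up to
a constant. -/
theorem four_pow_iterate_quarter_le {x : ℝ} {r : ℕ} (hx : (2 : ℝ) ^ r ≤ x) (t : ℕ) :
    ((4 ^ ((fun s => s - s / 4)^[3 * (t + 1)] r) : ℕ) : ℝ) ≤ 64 * x ^ ((1 : ℝ) / 2 ^ t) := by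
  set y := (fun s : ℕ => s - s / 4)^[3 * (t + 1)] r with hy
  -- Three reductions at least halve the exponent, as `(3 / 4) ^ 3 ≤ 1 / 2`. The extra halving in `t
  -- + 1` compensates the factor `2` in `4 ^ y = 2 ^ (2 * y)`, and the additive `3` becomes `64 = 2
  -- ^ 6`.
  have h1 : (y : ℝ) ≤ (1 / 2) ^ (t + 1) * r + 3 := by
    refine (iterate_quarter_le _ _).trans ?_
    rw [pow_mul]
    gcongr
    norm_num
  have h2 : (2 : ℝ) * y ≤ r * ((1 : ℝ) / 2 ^ t) + 6 := by
    rw [pow_succ, one_div_pow] at h1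
    linarith
  calc ((4 ^ y : ℕ) : ℝ) = (2 : ℝ) ^ ((2 : ℝ) * y) := by
        push_cast
        rw [Real.rpow_mul (by norm_num), Real.rpow_natCast]
        norm_num
    _ ≤ (2 : ℝ) ^ (r * ((1 : ℝ) / 2 ^ t) + 6) :=
        Real.rpow_le_rpow_of_exponent_le (by norm_num) h2
    _ = ((2 : ℝ) ^ r) ^ ((1 : ℝ) / 2 ^ t) * 64 := by
        rw [Real.rpow_add (by norm_num), Real.rpow_mul (by norm_num), Real.rpow_natCast]
        congr 1
        norm_num
    _ ≤ x ^ ((1 : ℝ) / 2 ^ t) * 64 := by gcongr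
    _ = _ := mul_comm _ _

/-- Constants for the exponents of the block encodings and of the table. -/
theorem exists_parameters : ∃ γ κ : ℕ,
    (∀ e u v : ℕ, 0 < e → u = e.size → v = u.size → 10 * 8 ^ v + 8 ≤ γ + e) ∧ γ ≤ κ ∧
      8 * κ + 40 ≤ 2 ^ κ ∧ 3 * κ + 144 ≤ 2 ^ κ ∧ 4 * (2 * κ + 10 * γ + 100) + 1 ≤ 2 ^ κ := by
  obtain ⟨γ, hγ⟩ := exists_exponent_bound
  have h1 : γ + 1 ≤ 2 ^ γ := Nat.lt_two_pow_self
  have h2 : 2 ^ (γ + 12) = 4096 * 2 ^ γ := by rw [pow_add, mul_comm]; norm_num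
  -- The shift by `12` multiplies `2 ^ γ` by `4096`, which exceeds each of the three expressions,
  -- all linear in `γ`.
  refine ⟨γ, γ + 12, hγ, by omega, ?_, ?_, ?_⟩ <;> rw [h2] <;> omega

/-- The data structure for one array. -/
theorem exists_structure {γ κ η b : ℕ}
    (hγ : ∀ e u v : ℕ, 0 < e → u = e.size → v = u.size → 10 * 8 ^ v + 8 ≤ γ + e) (hγκ : γ ≤ κ)
    (hκ : 8 * κ + 40 ≤ 2 ^ κ) (hκ3 : 3 * κ + 144 ≤ 2 ^ κ) (hη : η = 2 * κ + 10 * γ + 100)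
    (hη4 : 4 * η + 1 ≤ 2 ^ κ)
    -- The summands pay, in order, for the header, the two top levels, the table, the blocks that
    -- refer to it, and the quarter levels.
    (hb : b = (8 * η + 1) + (96 * κ + 1008) + 2 ^ (γ + 1) + 4 * (3 * κ + 144) + 2000 * (κ + 4))
    {n m : ℕ} (k : ℕ) (hm : 1 ≤ m) (hmn : m ≤ n) {A : Fin n → Fin n → ℕ} (hA : A ∈ IMS2 n m)
    {w : ℕ} (hw : (5 * η + 3) * (Nat.log 2 n + 1) ≤ w) :
    ∃ D : List Bool,
      (D.length : ℝ) ≤ (b : ℝ) * 4 ^ k * n * m * ((n : ℝ) / m) ^ ((1 : ℝ) / 2 ^ (2 ^ k)) ∧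
        ∀ i j : Fin n, WordRAM.Answers w D WordRAM.queryProgram i j (A i j)
          (11 * WordRAM.queryCost * 2 ^ k) := by
  have hn : 0 < n := by omega
  obtain ⟨e, he⟩ : ∃ e, e = Nat.log 2 n + 1 := ⟨_, rfl⟩
  rw [← he] at hw
  have hne : n < 2 ^ e := he ▸ Nat.lt_pow_succ_log_self (by norm_num) n
  have hen : 2 ^ e ≤ 2 * n := by
    have := Nat.pow_log_le_self 2 hn.ne'
    rw [he, pow_succ]; omega
  have he0 : 0 < e := by omega
  have hen' : e ≤ 2 * n := Nat.lt_two_pow_self.le.trans hen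
  -- `H` bounds all field widths and is still a constant times `log n`, so a word can hold the
  -- header and every address.
  obtain ⟨H, hHdef⟩ : ∃ H, H = η * e := ⟨_, rfl⟩
  obtain ⟨r, hrdef⟩ : ∃ r, r = Nat.log 2 (n / m) := ⟨_, rfl⟩
  have hnm1 : 1 ≤ n / m := (Nat.one_le_div_iff (by omega)).2 hmn
  have hr1 : 2 ^ r ≤ n / m := hrdef ▸ Nat.pow_log_le_self 2 (by omega)
  have hr2 : n ≤ 2 * m * 2 ^ r := by
    have h1 : n / m < 2 ^ (r + 1) := hrdef ▸ Nat.lt_pow_succ_log_self (by norm_num) _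
    have h2 := (Nat.div_lt_iff_lt_mul (by omega)).1 h1
    rw [pow_succ] at h2
    have h3 : 2 ^ r * 2 * m = 2 * m * 2 ^ r := by ring
    omega
  have hre : r ≤ e := by
    rw [hrdef, he]
    exact (Nat.log_mono_right (Nat.div_le_self n m)).trans (Nat.le_succ _)
  obtain ⟨u, hu⟩ : ∃ u, u = e.size := ⟨_, rfl⟩
  obtain ⟨v, hv⟩ : ∃ v, v = u.size := ⟨_, rfl⟩
  have hu2 : e < 2 ^ u := hu ▸ Nat.lt_size_self _
  have hv2 : u < 2 ^ v := hv ▸ Nat.lt_size_self _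
  have hue : u ≤ e := hu ▸ size_le_self e
  have hvu : v ≤ u := hv ▸ size_le_self u
  have hexp : 10 * 8 ^ v + 8 ≤ γ + e := hγ e u v he0 hu hv
  have hmax : max r v ≤ min e (r + 2 * u) := by omega
  have hηe : η ≤ H := hHdef ▸ Nat.le_mul_of_pos_right _ he0
  have hHexp : κ + 10 * γ + 90 + κ * e + 10 * e ≤ H := by
    have h1 : (2 * κ + 10 * γ + 100) * e = 2 * (κ * e) + 10 * (γ * e) + 100 * e := by ring
    have h2 := Nat.le_mul_of_pos_right γ he0
    have h3 := Nat.le_mul_of_pos_right κ he0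
    rw [hHdef, hη, h1]
    omega
  have hκe : κ ≤ κ * e := Nat.le_mul_of_pos_right _ he0
  have hHw : 5 * H + 3 ≤ w := by
    refine le_trans ?_ hw
    have h1 : (5 * η + 3) * e = 5 * (η * e) + 3 * e := by ring
    rw [hHdef, h1]
    omega
  have hH1 : κ + 5 * e + 1 ≤ H := by omega
  -- The table starts at address `O(log n)`, which has `O(log log n)` bits; this is `O(2 ^ v)`
  -- because `u < 2 ^ v`.
  have hHbase : 4 * H + 1 ≤ 2 ^ (κ + 2 ^ v) := by
    calc 4 * H + 1 ≤ 4 * (η * e) + e := by rw [hHdef]; omega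
      _ = (4 * η + 1) * e := by ring
      _ ≤ 2 ^ κ * 2 ^ u := Nat.mul_le_mul hη4 hu2.le
      _ = 2 ^ (κ + u) := (pow_add _ _ _).symm
      _ ≤ _ := Nat.pow_le_pow_right (by norm_num) (by omega)
  have hHpow : 4 * H + 1 + 2 ^ (γ + e) < 2 ^ H := by
    have h1 : 2 ^ (γ + e) * 2 ≤ 2 ^ H := by
      rw [← pow_succ]; exact Nat.pow_le_pow_right (by norm_num) (by omega)
    have h2 : (H - 5) + 1 ≤ 2 ^ (H - 5) := Nat.lt_two_pow_self
    have h3 : 2 ^ H = 2 ^ (H - 5) * 32 := by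
      rw [show (32 : ℕ) = 2 ^ 5 by norm_num, ← pow_add]; congr 1; omega
    omega
  have hwpow : ∀ t, t ≤ 2 ^ (γ + e) → 4 * H + 1 + t + 2 ^ (κ + 5 * e) + 1 < 2 ^ w := by
    intro t ht
    have h1 : 2 ^ (κ + 5 * e) ≤ 2 ^ H := Nat.pow_le_pow_right (by norm_num) (by omega)
    have h2 : 2 ^ H * 4 ≤ 2 ^ w := by
      rw [show (4 : ℕ) = 2 ^ 2 by norm_num, ← pow_add]
      exact Nat.pow_le_pow_right (by norm_num) (by omega)
    omega
  have hheader : 4 * H + 1 ≤ (8 * η + 1) * (n * m) := by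
    have h1 : η * e ≤ η * (2 * n) := Nat.mul_le_mul_left _ hen'
    have h2 : η * (2 * n) = 2 * (η * n) := by ring
    calc 4 * H + 1 ≤ 8 * (η * n) + n := by rw [hHdef]; omega
      _ = (8 * η + 1) * n := by ring
      _ ≤ _ := Nat.mul_le_mul_left _ (Nat.le_mul_of_pos_right _ (by omega))
  set f := extendArray hn A with hf
  have hmono : Mono2 f := mono2_extendArray hn hA
  have hM : ∀ i j, f i j ≤ m := extendArray_le hn hA
  have hmR : (0 : ℝ) < m := by exact_mod_cast hm
  have hrR : (2 : ℝ) ^ r ≤ (n : ℝ) / m := by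
    have h1 : ((2 ^ r : ℕ) : ℝ) ≤ ((n / m : ℕ) : ℝ) := by exact_mod_cast hr1
    push_cast at h1
    exact h1.trans Nat.cast_div_le
  have hρ1 : (1 : ℝ) ≤ (n : ℝ) / m := by
    rw [one_le_div hmR]; exact_mod_cast hmn
  set R := ((n : ℝ) / m) ^ ((1 : ℝ) / 2 ^ (2 ^ k)) with hR
  have hR1 : 1 ≤ R := Real.one_le_rpow hρ1 (by positivity)
  have hk1 : 1 ≤ 2 ^ k := Nat.one_le_two_pow
  have h2k : 2 ^ k ≤ 4 ^ k := Nat.pow_le_pow_left (by norm_num) k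
  have h4k : (1 : ℝ) ≤ 4 ^ k := one_le_pow₀ (by norm_num)
  have hspace : ∀ (l : ℕ), (l : ℝ) ≤ b * (n * m) * (4 ^ k * R) →
      (l : ℝ) ≤ (b : ℝ) * 4 ^ k * n * m * R := by
    intro l h
    refine h.trans (le_of_eq ?_)
    ring
  rcases le_or_gt v r with hvr | hvr
  · -- few levels suffice because the ratio `n / m` is large
    have hmaxr : max r v = r := max_eq_left hvr
    -- `2 ^ k + 1` halvings of three reductions each, as required for the exponent `1 / 2 ^ (2 ^
    -- k)`.
    obtain ⟨τ, hτ⟩ : ∃ τ, τ = 3 * (2 ^ k + 1) := ⟨_, rfl⟩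
    have hlev : Levels 0 e (min e (r + 2 * u) :: max r v :: quarterLevels τ r) :=
      ⟨min_le_left _ _, hmax, by rw [hmaxr]; exact levels_quarterLevels _ _⟩
    obtain ⟨D, hDl, hD⟩ := exists_answers (h := 0) (w := w) (H := H) (T := []) hn hne hmn hA hκ hH1
      (by omega) hlev (length_constLeaf_le _ κ 0) (fun _ _ => by simp [constLeaf])
      (fun D _ _ X Y p _ _ i hi j hj => by
        obtain rfl : i = 0 := by simpa using hi
        obtain rfl : j = 0 := by simpa using hj
        have := Located.done (D := D) (K := H) 0 p 0 0
        simpa [constLeaf] using this)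
      (lt_of_le_of_lt (by simp) hHpow) (hwpow _ (Nat.zero_le _))
    refine ⟨D, hspace _ ?_, fun i j => ?_⟩
    · have h1 := totalLength_top_le hmono (leaf := constLeaf) hM hκ (length_constLeaf_le _ κ 0) hen
        hr2 hu2 hv2 hlev
      rw [hmaxr] at h1
      have h2 := totalLength_quarterLevels_le hmono hM hκ τ r hre
      obtain ⟨G, hG⟩ : ∃ G, G = 4 ^ ((fun s => s - s / 4)^[τ] r) := ⟨_, rfl⟩
      rw [← hG] at h2
      have h3 : 2 ^ e * m ≤ 2 * (n * m) := by
        calc 2 ^ e * m ≤ 2 * n * m := Nat.mul_le_mul_right _ hen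
          _ = _ := by ring
      have h4 : τ * (24 * (κ + 4) * 2 ^ e * m) + 12 * (κ + 4) * G * 2 ^ e * m ≤
          (48 * τ * (κ + 4) + 24 * (κ + 4) * G) * (n * m) := by
        calc _ = (24 * τ * (κ + 4) + 12 * (κ + 4) * G) * (2 ^ e * m) := by ring
          _ ≤ (24 * τ * (κ + 4) + 12 * (κ + 4) * G) * (2 * (n * m)) := Nat.mul_le_mul_left _ h3
          _ = _ := by ring
      have h5 : D.length ≤ ((8 * η + 1) + (96 * κ + 1008) + (48 * τ * (κ + 4) +
          24 * (κ + 4) * G)) * (n * m) := by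
        rw [hDl, hmaxr]
        simp only [List.length_nil, add_zero]
        calc _ ≤ (8 * η + 1) * (n * m) + ((96 * κ + 1008) * (n * m) + _) :=
              Nat.add_le_add hheader (h1.trans (Nat.add_le_add_left (h2.trans h4) _))
          _ = _ := by ring
      have h6 : (G : ℝ) ≤ 64 * R := by
        rw [hG, hτ]; exact four_pow_iterate_quarter_le hrR (2 ^ k)
      have h7 : (τ : ℝ) ≤ 6 * 4 ^ k := by
        have : τ ≤ 6 * 4 ^ k := by omega
        exact_mod_cast this
      set Q : ℝ := 4 ^ k * R with hQ
      have hQ1 : 1 ≤ Q := one_le_mul_of_one_le_of_one_le h4k hR1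
      have h8 : (4 : ℝ) ^ k ≤ Q := le_mul_of_one_le_right (by positivity) hR1
      have h9 : R ≤ Q := le_mul_of_one_le_left (by positivity) h4k
      have h10 : (((8 * η + 1) + (96 * κ + 1008) + (48 * τ * (κ + 4) +
          24 * (κ + 4) * G) : ℕ) : ℝ) ≤ b * Q := by
        have hb' : ((8 * η + 1) + (96 * κ + 1008) + 2000 * (κ + 4) : ℕ) ≤ b := by
          rw [hb, add_assoc _ (2 ^ (γ + 1))]
          exact Nat.add_le_add_right (Nat.le_add_right _ _) _
        have hb'' : (((8 * η + 1) + (96 * κ + 1008) + 2000 * (κ + 4) : ℕ) : ℝ) ≤ b := by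
          exact_mod_cast hb'
        have h11 : (τ : ℝ) ≤ 6 * Q := h7.trans (mul_le_mul_of_nonneg_left h8 (by norm_num))
        have h12 : (G : ℝ) ≤ 64 * Q := h6.trans (mul_le_mul_of_nonneg_left h9 (by norm_num))
        push_cast at hb'' ⊢
        have hκ0 : (0 : ℝ) ≤ (κ : ℝ) + 4 := by positivity
        calc (8 * (η : ℝ) + 1) + (96 * κ + 1008) + (48 * τ * (κ + 4) + 24 * (κ + 4) * G)
            ≤ ((8 * (η : ℝ) + 1) + (96 * κ + 1008)) * Q +
              (48 * (6 * Q) * (κ + 4) + 24 * (κ + 4) * (64 * Q)) := by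
              refine add_le_add (le_mul_of_one_le_right (by positivity) hQ1) ?_
              gcongr
          _ ≤ ((8 * (η : ℝ) + 1) + (96 * κ + 1008) + 2000 * (κ + 4)) * Q := by
              have h13 : 0 ≤ ((κ : ℝ) + 4) * Q := mul_nonneg hκ0 (zero_le_one.trans hQ1)
              rw [add_mul _ (2000 * ((κ : ℝ) + 4))]
              refine add_le_add_right ?_ _
              rw [show 48 * (6 * Q) * ((κ : ℝ) + 4) + 24 * (κ + 4) * (64 * Q) =
                1824 * (((κ : ℝ) + 4) * Q) by ring, mul_assoc]
              exact mul_le_mul_of_nonneg_right (by norm_num) h13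
          _ ≤ _ := by gcongr
      calc (D.length : ℝ) ≤ (((8 * η + 1) + (96 * κ + 1008) + (48 * τ * (κ + 4) +
          24 * (κ + 4) * G) : ℕ) : ℝ) * (n * m) := by exact_mod_cast h5
        _ ≤ b * Q * (n * m) := by gcongr
        _ = _ := by ring
    · obtain ⟨T, s, hT, h⟩ := hD i j
      refine ⟨T, s, hT.trans ?_, h⟩
      simp only [List.length_cons, length_quarterLevels]
      -- `τ + 5 = 3 * 2 ^ k + 8`, which is at most `11 * 2 ^ k`; this is the source of the constant
      -- `11`.
      calc WordRAM.queryCost * (0 + (τ + 1 + 1 + 1) + 2) ≤ WordRAM.queryCost * (11 * 2 ^ k) :=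
            Nat.mul_le_mul_left _ (by omega)
        _ = _ := by ring
  · -- the blocks of the second level are so small that they can be tabulated
    have hmaxv : max r v = v := max_eq_right hvr.le
    obtain ⟨T, leaf, hT, hleaf, hfst, hloc⟩ := exists_tableLeaf hmono hM hHbase
    replace hT : T.length ≤ 2 ^ (γ + e) := hT.trans (Nat.pow_le_pow_right (by norm_num) hexp)
    have hleaf' : ∀ X Y, (leaf X Y).2.length ≤ 2 ^ κ * 16 ^ v * blockDiff f v X Y := by
      intro X Y
      refine (hleaf X Y).trans ?_
      rw [← mul_assoc]
      exact Nat.mul_le_mul_right _ (Nat.mul_le_mul hκ3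
        (Nat.pow_le_pow_left (by norm_num) v))
    have hlev : Levels v e [min e (r + 2 * u), max r v] :=
      ⟨min_le_left _ _, hmax, hmaxv⟩
    have hsz := size_le_of_le_two_pow (hmn.trans hne.le)
    obtain ⟨D, hDl, hD⟩ := exists_answers (h := 2) (w := w) (H := H) (T := T) hn hne hmn hA hκ hH1
      (by omega) hlev hleaf' hfst (fun D hO hle => hloc D H hO hle (by omega) (by omega))
      (by omega) (hwpow _ hT)
    refine ⟨D, hspace _ ?_, fun i j => ?_⟩
    · have h1 := totalLength_top_le hmono hM hκ hleaf' hen hr2 hu2 hv2 hlev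
      rw [hmaxv] at h1
      have h2 := totalLength_nil_le hmono hM (hvu.trans hue) hleaf
      have h3 : 2 * (3 * κ + 144) * 2 ^ e * m ≤ 4 * (3 * κ + 144) * (n * m) := by
        calc 2 * (3 * κ + 144) * 2 ^ e * m ≤ 2 * (3 * κ + 144) * (2 * n) * m := by gcongr
          _ = _ := by ring
      have h4 : T.length ≤ 2 ^ (γ + 1) * (n * m) := by
        calc T.length ≤ 2 ^ γ * 2 ^ e := by rw [← pow_add]; exact hT
          _ ≤ 2 ^ γ * (2 * n) := Nat.mul_le_mul_left _ hen
          _ = 2 ^ (γ + 1) * n := by ring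
          _ ≤ _ := Nat.mul_le_mul_left _ (Nat.le_mul_of_pos_right _ (by omega))
      have h5 : D.length ≤ b * (n * m) := by
        rw [hDl, hmaxv]
        calc _ ≤ (8 * η + 1) * (n * m) + 2 ^ (γ + 1) * (n * m) + ((96 * κ + 1008) * (n * m) +
              4 * (3 * κ + 144) * (n * m)) :=
              Nat.add_le_add (Nat.add_le_add hheader h4)
                (h1.trans (Nat.add_le_add_left (h2.trans h3) _))
          _ = ((8 * η + 1) + 2 ^ (γ + 1) + (96 * κ + 1008) + 4 * (3 * κ + 144)) * (n * m) := by ring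
          _ ≤ b * (n * m) := Nat.mul_le_mul_right _ (by omega)
      have hQ1 : 1 ≤ 4 ^ k * R := one_le_mul_of_one_le_of_one_le h4k hR1
      calc (D.length : ℝ) ≤ b * (n * m) := by exact_mod_cast h5
        _ ≤ b * (n * m) * (4 ^ k * R) := le_mul_of_one_le_right (by positivity) hQ1
    · obtain ⟨T, s, hT, h⟩ := hD i j
      refine ⟨T, s, hT.trans ?_, h⟩
      simp only [List.length_cons, List.length_nil]
      calc WordRAM.queryCost * (2 + (0 + 1 + 1) + 2) ≤ WordRAM.queryCost * (11 * 2 ^ k) :=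
            Nat.mul_le_mul_left _ (by omega)
        _ = _ := by ring

theorem theorem2 :
    ∃ (P : WordRAM.Cmd) (a b c : ℕ),
      ∀ (n m k : ℕ), 1 ≤ m → m ≤ n → ∀ A ∈ IMS2 n m,
        ∀ w : ℕ, a * (Nat.log 2 n + 1) ≤ w →
          ∃ D : List Bool,
            (D.length : ℝ) ≤
                (b : ℝ) * 4 ^ k * n * m * ((n : ℝ) / m) ^ ((1 : ℝ) / 2 ^ (2 ^ k)) ∧
              ∀ i j : Fin n, WordRAM.Answers w D P i j (A i j) (c * 2 ^ k) := by
  obtain ⟨γ, κ, hγ, hγκ, hκ, hκ3, hη4⟩ := exists_parameters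
  refine ⟨WordRAM.queryProgram, 5 * (2 * κ + 10 * γ + 100) + 3,
    (8 * (2 * κ + 10 * γ + 100) + 1) + (96 * κ + 1008) + 2 ^ (γ + 1) + 4 * (3 * κ + 144) +
      2000 * (κ + 4), 11 * WordRAM.queryCost, ?_⟩
  intro n m k hm hmn A hA w hw
  exact exists_structure hγ hγκ hκ hκ3 rfl hη4 rfl k hm hmn hA hw
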